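/- Let $R$ be a left noetherian ring and let $n \ge 0$ be an integer. All modules are left $R$-modules, and $\mathrm{Ch}(R\text{-Mod})$ is the category of unbounded ($\mathbb{Z}$-indexed) chain complexes of modules. Let $\mathcal{P}_n$ be the class of modules $M$ of projective dimension at most $n$, that is, those admitting an exact sequence $0 \to P_n \to \cdots \to P_1 \to P_0 \to M \to 0$ with every $P_k$ projective. Let $\mathcal{P}_n^{\aleph_0}$ be the class of modules $M$ admitting such a sequence in which every $P_k$ is a direct sum $\bigoplus_{i \in I_k} P_k^i$ of countably generated projective modules over a countable index set $I_k$. For a class $\mathcal{A}$ of modules, let $\mathrm{dw}\widetilde{\mathcal{A}}$ be the class of chain complexes $X$ with $X_m \in \mathcal{A}$ for every $m \in \mathbb{Z}$. For a class $\mathcal{S}$ of complexes, let $\mathcal{S}^{\perp}$ be the class of complexes $Y$ with $\mathrm{Ext}^1(S, Y) = 0$ for all $S \in \mathcal{S}$, and ${}^{\perp}\mathcal{S}$ the class of complexes $X$ with $\mathrm{Ext}^1(X, S) = 0$ for all $S \in \mathcal{S}$, where $\mathrm{Ext}^1$ is taken in $\mathrm{Ch}(R\text{-Mod})$. An $\mathcal{S}$-filtration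 of a complex $X$ is a family $(X^\alpha : \alpha < \lambda)$ of subcomplexes of $X$, indexed by an ordinal $\lambda > 0$, such that $X^0 = 0$; $X^\alpha \subseteq X^{\alpha'}$ whenever $\alpha \le \alpha' < \lambda$; $X^\beta = \bigcup_{\alpha < \beta} X^\alpha$ for every limit ordinal $\beta < \lambda$; $X = \bigcup_{\alpha < \lambda} X^\alpha$; and $X^0$ as well as every quotient $X^{\alpha+1}/X^\alpha$ with $\alpha + 1 < \lambda$ is isomorphic to an element of $\mathcal{S}$. **Theorem.** 1. Every chain complex $X \in \mathrm{dw}\widetilde{\mathcal{P}_n}$ has a $\mathrm{dw}\widetilde{\mathcal{P}_n^{\aleph_0}}$-filtration. 2. The pair $(\mathrm{dw}\widetilde{\mathcal{P}_n}, (\mathrm{dw}\widetilde{\mathcal{P}_n})^{\perp})$ is a cotorsion pair in $\mathrm{Ch}(R\text{-Mod})$, that is, $\mathrm{dw}\widetilde{\mathcal{P}_n} = {}^{\perp}((\mathrm{dw}\widetilde{\mathcal{P}_n})^{\perp})$. It is cogenerated by the set $\mathrm{dw}\widetilde{\mathcal{P}_n^{\aleph_0}}$: this class has only a set of isomorphism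 classes, is contained in $\mathrm{dw}\widetilde{\mathcal{P}_n}$, and satisfies $(\mathrm{dw}\widetilde{\mathcal{P}_n^{\aleph_0}})^{\perp} = (\mathrm{dw}\widetilde{\mathcal{P}_n})^{\perp}$. 3. This cotorsion pair is complete: for every complex $X$ there are short exact sequences $0 \to B \to A \to X \to 0$ and $0 \to X \to B' \to A' \to 0$ with $A, A' \in \mathrm{dw}\widetilde{\mathcal{P}_n}$ and $B, B' \in (\mathrm{dw}\widetilde{\mathcal{P}_n})^{\perp}$. -/

import Mathlib

open CategoryTheory

universe w v u

namespace DegreewiseProj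

noncomputable section

section CotorsionPairs

variable {C : Type u} [Category.{v} C] [Abelian C]

/-- A pair `(A, B)` has enough projectives and enough injectives: every object `X` fits into
short exact sequences `0 ⟶ K ⟶ P ⟶ X ⟶ 0` and `0 ⟶ X ⟶ I ⟶ Q ⟶ 0` with `P, Q` in `A` and
`K, I` in `B`. -/
structure IsCompletePair (A B : ObjectProperty C) : Prop where
  enoughProjectives : ∀ X : C, ∃ (K P : C) (f : K ⟶ P) (g : P ⟶ X) (h : f ≫ g = 0),
    B K ∧ A P ∧ (ShortComplex.mk f g h).ShortExact
  enoughInjectives : ∀ X : C, ∃ (I Q : C) (f : X ⟶ I) (g : I ⟶ Q) (h : f ≫ g = 0),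
    B I ∧ A Q ∧ (ShortComplex.mk f g h).ShortExact

variable [HasExt.{w} C]

/-- The class `A^⊥` of objects `Y` with `Ext¹(X, Y) = 0` for every `X` in `A`. -/
def rightPerp (A : ObjectProperty C) : ObjectProperty C :=
  fun Y => ∀ X : C, A X → Subsingleton (Abelian.Ext.{w} X Y 1)

/-- The class `^⊥B` of objects `X` with `Ext¹(X, Y) = 0` for every `Y` in `B`. -/
def leftPerp (B : ObjectProperty C) : ObjectProperty C :=
  fun X => ∀ Y : C, B Y → Subsingleton (Abelian.Ext.{w} X Y 1)

/-- `(A, B)` is a cotorsion pair. -/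
structure IsCotorsionPair (A B : ObjectProperty C) : Prop where
  left_eq : A = leftPerp.{w} B
  right_eq : B = rightPerp.{w} A

/-- A cotorsion pair `(A, B)` is cogenerated by a set `S ⊆ A`, that is, `B = S^⊥`; here `S` is a
class of objects with only a set of isomorphism classes. -/
structure IsCogeneratedBySet (A B S : ObjectProperty C) : Prop where
  essentiallySmall : ObjectProperty.EssentiallySmall.{w} S
  le : S ≤ A
  right_eq : B = rightPerp.{w} S

end CotorsionPairs

section Modules

variable (R : Type u) [Ring R]

/-- `M` has a resolution `0 ⟶ P n ⟶ ⋯ ⟶ P 1 ⟶ P 0 ⟶ M ⟶ 0`, exact everywhere, with all `P k`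
(`0 ≤ k ≤ n`) in the class `Q`. The sequence is continued by zero modules, so that exactness at
the left end is included. -/
def HasResolutionOfLength (Q : ObjectProperty (ModuleCat.{u} R)) (n : ℕ) :
    ObjectProperty (ModuleCat.{u} R) := fun M =>
  ∃ (P : ℕ → ModuleCat.{u} R) (d : ∀ k, P (k + 1) →ₗ[R] P k) (ε : P 0 →ₗ[R] M),
    (∀ k ≤ n, Q (P k)) ∧ (∀ k > n, Subsingleton (P k)) ∧
    Function.Surjective ε ∧ Function.Exact (d 0) ε ∧ ∀ k, Function.Exact (d (k + 1)) (d k)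

/-- The class of left modules of projective dimension at most `n`. -/
def projDimLE (n : ℕ) : ObjectProperty (ModuleCat.{u} R) :=
  HasResolutionOfLength R (fun P => Module.Projective R P) n

/-- `M` is generated by a countable set. -/
def IsCountablyGenerated (M : ModuleCat.{u} R) : Prop :=
  ∃ s : Set M, s.Countable ∧ Submodule.span R s = ⊤

/-- `M` is a direct sum, over a countable index set, of countably generated projective modules. -/
def IsCountableSumOfCGProjective : ObjectProperty (ModuleCat.{u} R) := fun M =>
  ∃ (ι : Type) (_ : Countable ι) (N : ι → ModuleCat.{u} R),
    (∀ i, Module.Projective R (N i) ∧ IsCountablyGenerated R (N i)) ∧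
    Nonempty (M ≃ₗ[R] DirectSum ι fun i => N i)

/-- The class of modules having a resolution of length `n` by countable direct sums of countably
generated projective modules. -/
def projDimLEAleph0 (n : ℕ) : ObjectProperty (ModuleCat.{u} R) :=
  HasResolutionOfLength R (IsCountableSumOfCGProjective R) n

end Modules

section Complexes

variable {R : Type u} [Ring R]

/-- The class of unbounded chain complexes all of whose terms belong to `A`. -/
def dw (A : ObjectProperty (ModuleCat.{u} R)) :
    ObjectProperty (ChainComplex (ModuleCat.{u} R) ℤ) :=
  fun X => ∀ m : ℤ, A (X.X m)

/-- A subcomplex of a chain complex of modules. -/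
structure Subcomplex (X : ChainComplex (ModuleCat.{u} R) ℤ) where
  carrier : ∀ m : ℤ, Submodule R (X.X m)
  d_mem : ∀ i j : ℤ, ∀ x ∈ carrier i, (X.d i j).hom x ∈ carrier j

namespace Subcomplex

variable {X : ChainComplex (ModuleCat.{u} R) ℤ}

/-- The differential of a subcomplex. -/
def dRestrict (T : Subcomplex X) (i j : ℤ) : T.carrier i →ₗ[R] T.carrier j :=
  (X.d i j).hom.restrict (T.d_mem i j)

/-- A subcomplex, as a chain complex. -/
def toComplex (T : Subcomplex X) : ChainComplex (ModuleCat.{u} R) ℤ where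
  X m := ModuleCat.of R (T.carrier m)
  d i j := ModuleCat.ofHom (T.dRestrict i j)
  shape i j h := by
    ext x
    simp [dRestrict, X.shape i j h]
  d_comp_d' i j k _ _ := by
    ext x
    simp [dRestrict, ← ModuleCat.comp_apply]

/-- For subcomplexes `S ≤ T`, the submodule `S m` of `T m`. -/
def inside (S T : Subcomplex X) (m : ℤ) : Submodule R (T.carrier m) :=
  (S.carrier m).comap (T.carrier m).subtype

lemma inside_le (S T : Subcomplex X) (i j : ℤ) :
    S.inside T i ≤ (S.inside T j).comap (T.dRestrict i j) :=
  fun x hx => S.d_mem i j x.1 hx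

/-- For subcomplexes `S ≤ T`, the quotient complex `T / S`, with terms `T m / S m` and
differential `x + S i ↦ d x + S j`. -/
def quotient (T S : Subcomplex X) : ChainComplex (ModuleCat.{u} R) ℤ where
  X m := ModuleCat.of R (T.carrier m ⧸ S.inside T m)
  d i j := ModuleCat.ofHom
    ((S.inside T i).mapQ (S.inside T j) (T.dRestrict i j) (S.inside_le T i j))
  shape i j h := by
    have h0 : T.dRestrict i j = 0 := by
      ext x
      simp [dRestrict, X.shape i j h]
    ext x
    simp [h0]
  d_comp_d' i j k _ _ := by
    have h0 : ∀ x, T.dRestrict j k (T.dRestrict i j x) = 0 := by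
      intro x
      apply Subtype.ext
      simp [dRestrict, ← ModuleCat.comp_apply]
    ext x
    simp [h0]

end Subcomplex

/-- `(F α : α < l)` is a filtration of `X` by subcomplexes: it starts at `0`, is increasing,
continuous at limit ordinals below `l`, and its union is `X`. -/
structure IsFiltration (X : ChainComplex (ModuleCat.{u} R) ℤ) (l : Ordinal.{u})
    (F : Ordinal.{u} → Subcomplex X) : Prop where
  pos : 0 < l
  zero : ∀ m, (F 0).carrier m = ⊥
  mono : ∀ α β, α ≤ β → β < l → ∀ m, (F α).carrier m ≤ (F β).carrier m
  limit : ∀ β, Order.IsSuccLimit β → β < l →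
    ∀ m (x : X.X m), x ∈ (F β).carrier m ↔ ∃ α < β, x ∈ (F α).carrier m
  exhaust : ∀ m (x : X.X m), ∃ α < l, x ∈ (F α).carrier m

/-- `X` has an `S`-filtration: a filtration `(F α : α < l)` whose first term and whose successive
quotients `F (α + 1) / F α`, for `α + 1 < l`, are isomorphic to objects of `S`. -/
def HasFiltration (S : ObjectProperty (ChainComplex (ModuleCat.{u} R) ℤ))
    (X : ChainComplex (ModuleCat.{u} R) ℤ) : Prop :=
  ∃ (l : Ordinal.{u}) (F : Ordinal.{u} → Subcomplex X), IsFiltration X l F ∧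
    S.isoClosure (F 0).toComplex ∧
    ∀ α : Ordinal.{u}, α + 1 < l → S.isoClosure ((F (α + 1)).quotient (F α))

end Complexes

end

end DegreewiseProj

/-!
A complex `X` in `dw P_n` is studied together with projective resolutions of length `n` of all its
terms, chosen independently of the differential of `X`. Consider families `Q` consisting of a
submodule of every `X m` and of every term of the resolutions. Such a family is good
(`Resolved.IsGood`) if it is closed under the differential of `X` and the maps of the resolutions,
if the augmented resolutions restrict to exact sequences on it, and if, for a fixed section
`s : P ⟶ R^(P)` for every term `P` of the resolutions, `s x` is supported in `Q` for `x` in `Q`.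
The last condition makes `Q' / Q` a family of direct summands of free modules whenever `Q ≤ Q'` are
good (`projective_quotient`), so that `Q' / Q` is a projective resolution of the quotient of the
underlying subcomplexes of `X`. It replaces Kaplansky's decomposition of projective modules into
countably generated ones.

All these conditions are finitary, and over a good family a countable set of new elements has only
countably many consequences; for exactness this is where `R` has to be noetherian, as the cycles to
be lifted form a submodule of a countably generated module (`isClosureCondition_lift`). Hence good
families are closed under directed unions, and any countable set can be adjoined to a good family
with a quotient in `dw P_n^ℵ₀` (`Resolved.IsGood.exists_extension`). Adjoining the elements of `X`
one after the other gives the filtration (`hasFiltration_of_dw_projDimLE`).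

The same two facts give `(dw P_n^ℵ₀)^⊥ = (dw P_n)^⊥` (`subsingleton_ext_of_dw_projDimLE`): given an
epimorphism onto `X` with kernel `Y` in `(dw P_n^ℵ₀)^⊥`, a section over the subcomplex of a good
family extends along an enlargement, and a maximal one is defined on all of `X`.

For the cotorsion pair, `P_n` is the left orthogonal of `P_n^⊥`, which contains the `n`-th
cosyzygies of all modules. Evaluation in degree `j` is exact and has the exact right adjoint
sending a module to its disk in degrees `j + 1` and `j`, so `dw P_n` is the left orthogonal of the
class of disks on modules in `P_n^⊥` (`dw_projDimLE_eq_leftPerp`).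

Completeness follows from the small object argument, applied to the inclusions `K ⟶ P` for
projective presentations `P ⟶ s` of the objects of a small set representing `dw P_n^ℵ₀`. In the
resulting factorization `Y ⟶ B ⟶ 0`, the lifting property of `B` is the vanishing of `Ext¹(s, B)`,
while the lifting property of `Y ⟶ B` shows that it is a monomorphism with cokernel in the left
orthogonal of `(dw P_n^ℵ₀)^⊥` (`exists_special_preenvelope`). The other exact sequence is obtained
from this one by a pushout (`exists_special_precover`).
-/

namespace DegreewiseProj

/-! ### Vanishing of `Ext¹` and splitting of extensions -/

section Extensions

open Limits Abelian

variable {C : Type u} [Category.{v} C] [Abelian C]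

lemma shortExact_of_epi {X Y : C} (p : X ⟶ Y) [Epi p] :
    (ShortComplex.mk (kernel.ι p) p (kernel.condition p)).ShortExact where
  exact := ShortComplex.exact_of_f_is_kernel _ (kernelIsKernel p)

lemma shortExact_of_mono {X Y : C} (i : X ⟶ Y) [Mono i] :
    (ShortComplex.mk i (cokernel.π i) (cokernel.condition i)).ShortExact where
  exact := ShortComplex.exact_of_g_is_cokernel _ (cokernelIsCokernel i)

variable [HasExt.{w} C]

lemma exists_lift_of_subsingleton_ext {S : ShortComplex C} (hS : S.ShortExact) {X : C}
    (h : Subsingleton (Ext.{w} X S.X₁ 1)) (f : X ⟶ S.X₃) : ∃ g : X ⟶ S.X₂, g ≫ S.g = f := by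
  obtain ⟨x, hx⟩ := Ext.covariant_sequence_exact₃ X hS (Ext.mk₀ f) (zero_add 1)
    (Subsingleton.elim _ _)
  obtain ⟨s, rfl⟩ := Ext.homEquiv₀.symm.surjective x
  refine ⟨s, Ext.homEquiv₀.symm.injective ?_⟩
  simpa using hx

lemma exists_extension_of_subsingleton_ext {S : ShortComplex C} (hS : S.ShortExact) {Y : C}
    (h : Subsingleton (Ext.{w} S.X₃ Y 1)) (f : S.X₁ ⟶ Y) : ∃ g : S.X₂ ⟶ Y, S.f ≫ g = f := by
  obtain ⟨x, hx⟩ := Ext.contravariant_sequence_exact₁ hS Y (Ext.mk₀ f) (add_zero 1)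
    (Subsingleton.elim _ _)
  obtain ⟨s, rfl⟩ := Ext.homEquiv₀.symm.surjective x
  refine ⟨s, Ext.homEquiv₀.symm.injective ?_⟩
  simpa using hx

/-- If `S.X₂` is injective, then `Ext¹(X, S.X₁)` is the cokernel of
`Hom(X, S.X₂) ⟶ Hom(X, S.X₃)`. -/
lemma subsingleton_ext_of_injective {S : ShortComplex C} (hS : S.ShortExact) [Injective S.X₂]
    {X : C} (h : ∀ f : X ⟶ S.X₃, ∃ g : X ⟶ S.X₂, g ≫ S.g = f) :
    Subsingleton (Ext.{w} X S.X₁ 1) := by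
  refine subsingleton_of_forall_eq 0 fun e => ?_
  obtain ⟨x, rfl⟩ := Ext.covariant_sequence_exact₁ X hS e (Ext.eq_zero_of_injective _)
    (zero_add 1)
  obtain ⟨f, rfl⟩ := Ext.homEquiv₀.symm.surjective x
  obtain ⟨g, rfl⟩ := h f
  rw [Ext.homEquiv₀_symm_apply, ← Ext.mk₀_comp_mk₀, Ext.comp_assoc_of_second_deg_zero,
    hS.comp_extClass, Ext.comp_zero]

lemma subsingleton_ext_of_projective {S : ShortComplex C} (hS : S.ShortExact) [Projective S.X₂]
    {Y : C} (h : ∀ f : S.X₁ ⟶ Y, ∃ g : S.X₂ ⟶ Y, S.f ≫ g = f) :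
    Subsingleton (Ext.{w} S.X₃ Y 1) := by
  refine subsingleton_of_forall_eq 0 fun e => ?_
  obtain ⟨x, rfl⟩ := Ext.contravariant_sequence_exact₃ hS Y e (Ext.eq_zero_of_projective _)
    (add_zero 1)
  obtain ⟨f, rfl⟩ := Ext.homEquiv₀.symm.surjective x
  obtain ⟨g, rfl⟩ := h f
  rw [Ext.homEquiv₀_symm_apply, ← Ext.mk₀_comp_mk₀, hS.extClass_comp_assoc]

/-- `Ext¹(X, Y)` vanishes as soon as every epimorphism onto `X` with kernel `Y` splits. -/
lemma subsingleton_ext_of_forall_split [EnoughInjectives C] {X Y : C}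
    (h : ∀ (E : C) (i : Y ⟶ E) (p : E ⟶ X) (w : i ≫ p = 0),
      (ShortComplex.mk i p w).ShortExact → ∃ s : X ⟶ E, s ≫ p = 𝟙 X) :
    Subsingleton (Ext.{w} X Y 1) := by
  have hS := shortExact_of_mono (Injective.ι Y)
  have : Injective (ShortComplex.mk (Injective.ι Y) _ (cokernel.condition _)).X₂ :=
    inferInstanceAs (Injective (Injective.under Y))
  refine subsingleton_ext_of_injective hS fun f => ?_
  dsimp at f ⊢
  let π := cokernel.π (Injective.ι Y)
  -- the pullback of `0 ⟶ Y ⟶ I ⟶ I / Y ⟶ 0` along `f` splits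
  obtain ⟨i, hi₁, hi⟩ : ∃ i : Y ⟶ pullback π f,
      i ≫ pullback.fst π f = Injective.ι Y ∧ i ≫ pullback.snd π f = 0 :=
    ⟨pullback.lift (Injective.ι Y) 0 (by simp [π]), pullback.lift_fst _ _ _,
      pullback.lift_snd _ _ _⟩
  have hE : (ShortComplex.mk i (pullback.snd π f) hi).ShortExact := by
    have : Mono i := mono_of_mono_fac hi₁
    refine ShortComplex.ShortExact.mk' ?_ this inferInstance
    refine ShortComplex.exact_of_f_is_kernel _ (KernelFork.IsLimit.ofι' _ _ fun {A} k hk => ?_)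
    have hk' : (k ≫ pullback.fst π f) ≫ π = 0 := by
      rw [Category.assoc, pullback.condition, reassoc_of% hk, zero_comp]
    refine ⟨hS.exact.lift (k ≫ pullback.fst π f) hk', ?_⟩
    apply pullback.hom_ext
    · simpa [hi₁] using hS.exact.lift_f (k ≫ pullback.fst π f) hk'
    · simpa [hi] using hk.symm
  obtain ⟨s, hs⟩ := h _ i _ hi hE
  exact ⟨s ≫ pullback.fst π f, by rw [Category.assoc, pullback.condition, reassoc_of% hs]⟩

lemma subsingleton_ext_of_iso_left {X X' Y : C} (e : X ≅ X') {k : ℕ}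
    (h : Subsingleton (Ext.{w} X Y k)) : Subsingleton (Ext.{w} X' Y k) := by
  refine subsingleton_of_forall_eq 0 fun x => ?_
  have : (Ext.mk₀ e.inv).comp ((Ext.mk₀ e.hom).comp x (zero_add k)) (zero_add k) = x := by
    simp
  rw [← this, Subsingleton.elim ((Ext.mk₀ e.hom).comp x (zero_add k)) 0, Ext.comp_zero]

lemma rightPerp_antitone {S T : ObjectProperty C} (h : S ≤ T) :
    rightPerp.{w} T ≤ rightPerp.{w} S :=
  fun _ hY X hX => hY X (h X hX)

lemma le_leftPerp_rightPerp (S : ObjectProperty C) : S ≤ leftPerp.{w} (rightPerp.{w} S) :=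
  fun X hX _ hY => hY X hX

/-- A left orthogonal class is the left orthogonal of its right orthogonal. -/
lemma isCotorsionPair_of_eq_leftPerp {A B : ObjectProperty C} (h : A = leftPerp.{w} B) :
    IsCotorsionPair.{w} A (rightPerp.{w} A) where
  left_eq := by
    refine le_antisymm (le_leftPerp_rightPerp A) ?_
    intro X hX
    rw [h]
    refine fun Y hY => hX Y ?_
    rw [h]
    exact fun X' hX' => hX' Y hY
  right_eq := rfl

end Extensions

/-! ### Special preenvelopes and precovers by the small object argument -/

section SmallObjectArgument

open Limits Abelian ZeroObject

variable {C : Type u} [Category.{v} C] [Abelian C] [IsGrothendieckAbelian.{w} C]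

open MorphismProperty in
/-- In a Grothendieck abelian category, every small class of monomorphisms permits the small
object argument. -/
lemma hasSmallObjectArgument_of_le_monomorphisms (I : MorphismProperty C) [IsSmall.{w} I]
    (hI : I ≤ monomorphisms C) : HasSmallObjectArgument.{w} I := by
  obtain ⟨κ, hκ', hκ⟩ := HasCardinalLT.exists_regular_cardinal_forall.{w}
    (fun f : I.toSet => Subobject f.1.left)
  have : Fact κ.IsRegular := ⟨hκ'⟩
  have : Nonempty κ.ord.ToType := by simpa using hκ'.ne_zero
  have := WellFoundedLT.toOrderBot κ.ord.ToType
  exact ⟨κ, inferInstance, inferInstance,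
    { preservesColimit {A B X Y} i hi f hf := by
        let hf' : (monomorphisms C).TransfiniteCompositionOfShape κ.ord.ToType f :=
          { toTransfiniteCompositionOfShape := hf.toTransfiniteCompositionOfShape
            map_mem j hj := by
              have := (hf.attachCells j hj).pushouts_coproducts
              simp only [ofHoms_homFamily] at this
              refine (?_ : _ ≤ monomorphisms C) _ this
              simp only [pushouts_le_iff, coproducts_le_iff]
              exact hI }
        have (j j' : κ.ord.ToType) (φ : j ⟶ j') : Mono (hf'.F.map φ) := hf'.mem_map φ
        exact IsGrothendieckAbelian.preservesColimit_coyoneda_obj_of_mono (Y := hf'.F) (κ := κ)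
          (hκ ⟨Arrow.mk i, hi⟩) }⟩

variable [EnoughProjectives C] [HasExt.{w} C]

/-- The embedding `Y ⟶ B` is produced by the small object argument applied to `Y ⟶ 0` and the
kernels `K ⟶ P` of projective presentations `P ⟶ s` of objects of `S`. That `B ⟶ 0` lifts against
these is the vanishing of `Ext¹(s, B)`, and that `Y ⟶ B` lifts against everything which lifts
against these gives both its injectivity and the vanishing of `Ext¹(B / Y, Z)` for `Z` in `S^⊥`. -/
theorem exists_special_preenvelope (S : ObjectProperty C) [ObjectProperty.EssentiallySmall.{w} S]
    (Y : C) : ∃ (B Q : C) (f : Y ⟶ B) (g : B ⟶ Q) (h : f ≫ g = 0),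
      rightPerp.{w} S B ∧ leftPerp.{w} (rightPerp.{w} S) Q ∧
        (ShortComplex.mk f g h).ShortExact := by
  obtain ⟨S₀, _, hS₀, hS⟩ := ObjectProperty.EssentiallySmall.exists_small_le.{w} S
  let I : MorphismProperty C := MorphismProperty.ofHoms
    (fun s : Subtype S₀ => kernel.ι (Projective.π s.1))
  have hI : I ≤ MorphismProperty.monomorphisms C := by
    rintro _ _ _ ⟨s⟩
    exact inferInstanceAs (Mono (kernel.ι _))
  have := hasSmallObjectArgument_of_le_monomorphisms.{w} I hI
  obtain ⟨B, f, p, hf, hp⟩ : ∃ (B : C) (f : Y ⟶ B) (p : B ⟶ 0), I.rlp.llp f ∧ I.rlp p := by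
    let fac := MorphismProperty.factorizationData I.rlp.llp I.rlp (0 : Y ⟶ 0)
    exact ⟨fac.Z, fac.i, fac.p, fac.hi, fac.hp⟩
  have hB : rightPerp.{w} S B := by
    rintro X hX
    obtain ⟨X', hX', ⟨e⟩⟩ := hS X hX
    refine subsingleton_ext_of_iso_left e.symm ?_
    have : Projective (ShortComplex.mk _ _ (kernel.condition (Projective.π X'))).X₂ :=
      inferInstanceAs (Projective (Projective.over X'))
    refine subsingleton_ext_of_projective (shortExact_of_epi (Projective.π X')) fun k => ?_
    have := hp _ ⟨⟨X', hX'⟩⟩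
    have sq : CommSq k (kernel.ι (Projective.π X')) p 0 := ⟨(isZero_zero C).eq_of_tgt _ _⟩
    exact ⟨sq.lift, sq.fac_left⟩
  have hmono : Mono f := by
    have hJ : I.rlp (0 : Injective.under Y ⟶ 0) := by
      rintro _ _ i hi
      have : Mono i := hI _ hi
      refine ⟨fun {a b} sq => ⟨⟨⟨Injective.factorThru a i, by simp, ?_⟩⟩⟩⟩
      exact (isZero_zero C).eq_of_tgt _ _
    have := hf _ hJ
    have sq : CommSq (Injective.ι Y) f (0 : Injective.under Y ⟶ 0) 0 :=
      ⟨(isZero_zero C).eq_of_tgt _ _⟩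
    exact mono_of_mono_fac sq.fac_left
  refine ⟨B, cokernel f, f, cokernel.π f, cokernel.condition f, hB, fun Z hZ => ?_,
    shortExact_of_mono f⟩
  refine subsingleton_ext_of_forall_split fun E i q w hE => ?_
  have hq : I.rlp q := by
    rintro _ _ _ ⟨s⟩
    refine ⟨fun {a b} sq => ?_⟩
    have : Epi q := hE.epi_g
    have := hE.mono_f
    -- `b` lifts to `E` by projectivity; the lift differs from `a` by a map to `Z`
    let t := Projective.factorThru b q
    have ht : t ≫ q = b := Projective.factorThru_comp _ _
    have hd : (a - kernel.ι (Projective.π s.1) ≫ t) ≫ q = 0 := by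
      simp [ht, sq.w]
    have hext := hZ s.1 (hS₀ _ s.2)
    obtain ⟨l, hl⟩ := hE.exact.lift' _ hd
    obtain ⟨c, hc⟩ := exists_extension_of_subsingleton_ext
      (shortExact_of_epi (Projective.π s.1)) hext l
    dsimp at hc hl
    refine ⟨⟨⟨t + c ≫ i, ?_, ?_⟩⟩⟩
    · rw [Preadditive.comp_add, reassoc_of% hc, hl]
      abel
    · rw [Preadditive.add_comp, ht, Category.assoc, w, comp_zero, add_zero]
  have := hf _ hq
  have sq : CommSq 0 f q (cokernel.π f) := ⟨by simp⟩
  have hz : f ≫ sq.lift = 0 := sq.fac_left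
  refine ⟨cokernel.desc f sq.lift hz, ?_⟩
  rw [← cancel_epi (cokernel.π f)]
  simp

/-- Salce's argument: special preenvelopes and enough projectives give special precovers. -/
theorem exists_special_precover (S : ObjectProperty C) [ObjectProperty.EssentiallySmall.{w} S]
    (X : C) : ∃ (K A : C) (f : K ⟶ A) (g : A ⟶ X) (h : f ≫ g = 0),
      rightPerp.{w} S K ∧ leftPerp.{w} (rightPerp.{w} S) A ∧
        (ShortComplex.mk f g h).ShortExact := by
  let π := Projective.π X
  obtain ⟨B, Q, f, g, w, hB, hQ, hS⟩ := exists_special_preenvelope.{w} S (kernel π)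
  have : Mono f := hS.mono_f
  let r : pushout (kernel.ι π) f ⟶ X := pushout.desc π 0 (by simp)
  have hl : pushout.inl (kernel.ι π) f ≫ r = π := pushout.inl_desc _ _ _
  have hr : pushout.inr (kernel.ι π) f ≫ r = 0 := pushout.inr_desc _ _ _
  refine ⟨B, pushout (kernel.ι π) f, pushout.inr _ _, r, hr, hB, fun Z hZ => ?_, ?_⟩
  · let q : pushout (kernel.ι π) f ⟶ Q := pushout.desc 0 g (by simp [w])
    have hq : pushout.inr (kernel.ι π) f ≫ q = g := pushout.inr_desc _ _ _
    have hq₀ : pushout.inl (kernel.ι π) f ≫ q = 0 := pushout.inl_desc _ _ _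
    have hE : (ShortComplex.mk _ q hq₀).ShortExact := by
      have : Epi g := hS.epi_g
      have := epi_of_epi_fac hq
      refine ShortComplex.ShortExact.mk' ?_ inferInstance this
      refine ShortComplex.exact_of_g_is_cokernel _
        (CokernelCofork.IsColimit.ofπ' _ _ fun {A} k hk => ?_)
      dsimp at k hk
      have hk' : f ≫ pushout.inr (kernel.ι π) f ≫ k = 0 := by
        rw [← pushout.condition_assoc, hk, comp_zero]
      refine ⟨hS.exact.desc _ hk', ?_⟩
      apply pushout.hom_ext
      · dsimp
        rw [reassoc_of% hq₀, zero_comp, hk]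
      · dsimp
        rw [reassoc_of% hq]
        exact hS.exact.g_desc _ hk'
    refine subsingleton_of_forall_eq 0 fun e => ?_
    obtain ⟨e', rfl⟩ := Ext.contravariant_sequence_exact₂ hE Z e (Ext.eq_zero_of_projective
      (P := Projective.over X) _)
    have : e' = 0 := (hQ Z hZ).elim _ _
    rw [this, Ext.comp_zero]
  · have : Epi r := epi_of_epi_fac hl
    refine ShortComplex.ShortExact.mk' ?_ inferInstance inferInstance
    refine ShortComplex.exact_of_g_is_cokernel _
      (CokernelCofork.IsColimit.ofπ' _ _ fun {A} k hk => ?_)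
    dsimp at k hk
    have hk' : kernel.ι π ≫ pushout.inl (kernel.ι π) f ≫ k = 0 := by
      rw [pushout.condition_assoc, hk, comp_zero]
    have hπ := shortExact_of_epi π
    refine ⟨hπ.exact.desc _ hk', ?_⟩
    apply pushout.hom_ext
    · dsimp
      rw [reassoc_of% hl]
      exact hπ.exact.g_desc _ hk'
    · dsimp
      rw [reassoc_of% hr, zero_comp, hk]

end SmallObjectArgument

/-! ### Disk complexes -/

section Disks

open Limits Abelian ZeroObject

variable {R : Type u} [Ring R]

lemma down_rel (j : ℤ) : (ComplexShape.down ℤ).Rel (j + 1) j := rfl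

lemma succ_ne (j : ℤ) : j + 1 ≠ j := by lia

/-- The disk on a module `M`: the complex with `M` in degrees `j + 1` and `j`, the differential
between them being the identity. -/
noncomputable abbrev disk (j : ℤ) (M : ModuleCat.{u} R) : ChainComplex (ModuleCat.{u} R) ℤ :=
  HomologicalComplex.double (𝟙 M) (down_rel j)

lemma projective_disk (j : ℤ) (P : ModuleCat.{u} R) [Projective P] : Projective (disk j P) where
  factors {E X} f e _ := by
    let H := HomologicalComplex.evalCompCoyonedaCorepresentableByDoubleId (down_rel j)
      (succ_ne j) P
    have : Epi (e.f (j + 1)) :=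
      (HomologicalComplex.eval (ModuleCat.{u} R) (ComplexShape.down ℤ) (j + 1)).map_epi e
    let f' : P ⟶ X.X (j + 1) := H.homEquiv f
    let t : P ⟶ E.X (j + 1) := Projective.factorThru f' (e.f (j + 1))
    obtain ⟨φ, hφ⟩ := H.homEquiv.surjective t
    refine ⟨φ, ?_⟩
    apply H.homEquiv.injective
    rw [H.homEquiv_comp, hφ]
    exact Projective.factorThru_comp f' (e.f (j + 1))

instance enoughProjectives_chainComplex :
    EnoughProjectives (ChainComplex (ModuleCat.{u} R) ℤ) where
  presentation X := by
    let D (j : ULift.{u} ℤ) := disk j.down (Projective.over (X.X (j.down + 1)))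
    have (j : ULift.{u} ℤ) : Projective (D j) := projective_disk _ _
    let H (j : ULift.{u} ℤ) := HomologicalComplex.evalCompCoyonedaCorepresentableByDoubleId
      (down_rel j.down) (succ_ne j.down) (Projective.over (X.X (j.down + 1)))
    let φ (j : ULift.{u} ℤ) : D j ⟶ X := (H j).homEquiv.symm (Projective.π (X.X (j.down + 1)))
    have hφ (j : ULift.{u} ℤ) : Epi ((φ j).f (j.down + 1)) := by
      have := (H j).homEquiv.apply_symm_apply (Projective.π (X.X (j.down + 1)))
      refine epi_of_epi_fac (f := (HomologicalComplex.doubleXIso₀ _ _).inv)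
        (h := Projective.π (X.X (j.down + 1))) ?_
      exact this
    have : HasColimitsOfSize.{u, u} (ChainComplex (ModuleCat.{u} R) ℤ) :=
      ⟨fun J _ => inferInstance⟩
    have hP : Projective (∐ D) := inferInstance
    refine ⟨{ p := ∐ D, projective := inferInstance, f := Sigma.desc φ, epi := ?_ }⟩
    have (j : ℤ) : Epi ((Sigma.desc φ).f j) := by
      obtain ⟨j, rfl⟩ : ∃ i, j = i + 1 := ⟨j - 1, by lia⟩
      have := hφ ⟨j⟩
      have h : (Sigma.ι D ⟨j⟩).f (j + 1) ≫ (Sigma.desc φ).f (j + 1) = (φ ⟨j⟩).f (j + 1) := by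
        rw [← HomologicalComplex.comp_f, Sigma.ι_desc]
      exact epi_of_epi_fac h
    exact HomologicalComplex.epi_of_epi_f _ this

/-- Maps of complexes into a disk are determined by, and can be prescribed by, the component in
the lower degree. -/
lemma exists_toDisk (j : ℤ) {M : ModuleCat.{u} R} (X : ChainComplex (ModuleCat.{u} R) ℤ)
    (f : X.X j ⟶ M) : ∃ φ : X ⟶ disk j M,
      φ.f j ≫ (HomologicalComplex.doubleXIso₁ _ _ (succ_ne j)).hom = f := by
  classical
  refine ⟨{
    f := fun k =>
      if h₀ : k = j + 1 then eqToHom (by rw [h₀]) ≫ X.d (j + 1) j ≫ f ≫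
        (HomologicalComplex.doubleXIso₀ (𝟙 M) (down_rel j)).inv ≫ eqToHom (by rw [h₀])
      else if h₁ : k = j then eqToHom (by rw [h₁]) ≫ f ≫
        (HomologicalComplex.doubleXIso₁ (𝟙 M) (down_rel j) (succ_ne j)).inv ≫
          eqToHom (by rw [h₁])
      else 0
    comm' := ?_ }, ?_⟩
  · rintro _ k rfl
    by_cases h₁ : k = j
    · subst h₁
      simp [HomologicalComplex.double_d _ _ (succ_ne k)]
    · by_cases h₂ : k = j + 1
      · subst h₂
        rw [HomologicalComplex.double_d_eq_zero₀ _ _ _ _ (by lia)]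
        simp
      · exact (HomologicalComplex.isZero_double_X _ _ _ h₂ h₁).eq_of_tgt _ _
  · simp

lemma toDisk_ext {j : ℤ} {M : ModuleCat.{u} R} {X : ChainComplex (ModuleCat.{u} R) ℤ}
    {φ ψ : X ⟶ disk j M} (h : φ.f j = ψ.f j) : φ = ψ := by
  refine HomologicalComplex.to_double_hom_ext ?_ h
  have h₁ := φ.comm (j + 1) j
  have h₂ := ψ.comm (j + 1) j
  rw [h, ← h₂, HomologicalComplex.double_d _ _ (succ_ne j)] at h₁
  simpa using h₁

lemma shortExact_disk (j : ℤ) {S : ShortComplex (ModuleCat.{u} R)} (hS : S.ShortExact) :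
    ∃ (f : disk j S.X₁ ⟶ disk j S.X₂) (g : disk j S.X₂ ⟶ disk j S.X₃) (h : f ≫ g = 0),
      g.f j ≫ (HomologicalComplex.doubleXIso₁ _ _ (succ_ne j)).hom =
        (HomologicalComplex.doubleXIso₁ _ _ (succ_ne j)).hom ≫ S.g ∧
      (ShortComplex.mk f g h).ShortExact := by
  let e₁ (M : ModuleCat.{u} R) := HomologicalComplex.doubleXIso₁ (𝟙 M) (down_rel j) (succ_ne j)
  let e₀ (M : ModuleCat.{u} R) := HomologicalComplex.doubleXIso₀ (𝟙 M) (down_rel j)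
  have key {M N : ModuleCat.{u} R} (a : M ⟶ N) : ∃ φ : disk j M ⟶ disk j N,
      φ.f j ≫ (e₁ N).hom = (e₁ M).hom ≫ a ∧ φ.f (j + 1) ≫ (e₀ N).hom = (e₀ M).hom ≫ a := by
    obtain ⟨φ, hφ⟩ := exists_toDisk j (disk j M) ((e₁ M).hom ≫ a)
    refine ⟨φ, hφ, ?_⟩
    have h := φ.comm (j + 1) j =≫ (e₁ N).hom
    rw [Category.assoc, Category.assoc, hφ, HomologicalComplex.double_d _ _ (succ_ne j),
      HomologicalComplex.double_d _ _ (succ_ne j)] at h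
    simpa [e₁, e₀] using h
  obtain ⟨f, hf, hf'⟩ := key S.f
  obtain ⟨g, hg, hg'⟩ := key S.g
  have hfg : f ≫ g = 0 := by
    apply toDisk_ext
    rw [← cancel_mono (e₁ S.X₃).hom]
    simp [hg, reassoc_of% hf]
  refine ⟨f, g, hfg, hg, HomologicalComplex.shortExact_of_degreewise_shortExact _ fun k => ?_⟩
  by_cases h₁ : k = j
  · subst h₁
    exact ShortComplex.shortExact_of_iso
      (ShortComplex.isoMk (e₁ _).symm (e₁ _).symm (e₁ _).symm
        (CommSq.mk hf).vert_inv.w.symm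
        (CommSq.mk hg).vert_inv.w.symm) hS
  · by_cases h₂ : k = j + 1
    · subst h₂
      exact ShortComplex.shortExact_of_iso
        (ShortComplex.isoMk (e₀ _).symm (e₀ _).symm (e₀ _).symm
          (CommSq.mk hf').vert_inv.w.symm
          (CommSq.mk hg').vert_inv.w.symm) hS
    · have hz (M : ModuleCat.{u} R) : IsZero ((disk j M).X k) :=
        HomologicalComplex.isZero_double_X _ _ _ h₂ h₁
      exact ShortComplex.ShortExact.mk' (ShortComplex.exact_of_isZero_X₂ _ (hz _))
        ⟨fun _ _ _ => (hz S.X₁).eq_of_tgt _ _⟩ ⟨fun _ _ _ => (hz S.X₃).eq_of_src _ _⟩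

instance injective_disk (j : ℤ) (J : ModuleCat.{u} R) [Injective J] : Injective (disk j J) where
  factors {X E} f e _ := by
    have : Mono (e.f j) := inferInstanceAs (Mono ((HomologicalComplex.eval _ _ j).map e))
    obtain ⟨φ, hφ⟩ := exists_toDisk j E (Injective.factorThru
      (f.f j ≫ (HomologicalComplex.doubleXIso₁ _ _ (succ_ne j)).hom) (e.f j))
    refine ⟨φ, toDisk_ext ?_⟩
    rw [← cancel_mono (HomologicalComplex.doubleXIso₁ _ _ (succ_ne j)).hom]
    simp [hφ]

/-- Both groups are computed by an injective copresentation of `M`, which the disk functor, being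
exact and right adjoint to evaluation in degree `j`, takes to one of the disk. -/
lemma subsingleton_ext_disk_iff (X : ChainComplex (ModuleCat.{u} R) ℤ) (j : ℤ)
    (M : ModuleCat.{u} R) :
    Subsingleton (Ext.{u} X (disk j M) 1) ↔ Subsingleton (Ext.{u} (X.X j) M 1) := by
  let S := ShortComplex.mk (Injective.ι M) _ (cokernel.condition _)
  have hS : S.ShortExact := shortExact_of_mono (Injective.ι M)
  have : Injective S.X₂ := inferInstanceAs (Injective (Injective.under M))
  obtain ⟨f, g, h, hg, hD⟩ := shortExact_disk j hS
  constructor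
  · intro hX
    refine subsingleton_ext_of_injective hS fun a => ?_
    obtain ⟨α, hα⟩ := exists_toDisk j X a
    obtain ⟨β, hβ⟩ := exists_lift_of_subsingleton_ext hD hX α
    refine ⟨β.f j ≫
      (HomologicalComplex.doubleXIso₁ (𝟙 S.X₂) (down_rel j) (succ_ne j)).hom, ?_⟩
    rw [← hα, Category.assoc, ← hg, ← hβ, HomologicalComplex.comp_f, Category.assoc]
  · intro hX
    have : Injective (ShortComplex.mk f g h).X₂ := injective_disk j S.X₂
    refine subsingleton_ext_of_injective hD fun a => ?_
    let e₃ := HomologicalComplex.doubleXIso₁ (𝟙 S.X₃) (down_rel j) (succ_ne j)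
    obtain ⟨b, hb⟩ := exists_lift_of_subsingleton_ext hS hX (a.f j ≫ e₃.hom)
    obtain ⟨β, hβ⟩ := exists_toDisk j X b
    refine ⟨β, toDisk_ext ?_⟩
    rw [← cancel_mono e₃.hom, ← hb, ← hβ, HomologicalComplex.comp_f, Category.assoc,
      Category.assoc, ← hg]

end Disks

/-! ### Projective dimension and degreewise orthogonality -/

section ProjectiveDimension

open Limits Abelian ZeroObject

variable {R : Type u} [Ring R]

lemma shortExact_of_function_exact {A B D : ModuleCat.{u} R} (f : A ⟶ B) (g : B ⟶ D)
    (w : f ≫ g = 0) (hf : Function.Injective f.hom) (hg : Function.Surjective g.hom)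
    (hfg : Function.Exact f.hom g.hom) : (ShortComplex.mk f g w).ShortExact :=
  ShortComplex.ShortExact.mk'
    ((ShortComplex.ShortExact.moduleCat_exact_iff_function_exact _).2 hfg)
    ((ModuleCat.mono_iff_injective _).2 hf) ((ModuleCat.epi_iff_surjective _).2 hg)

lemma shortExact_ker {P M : ModuleCat.{u} R} (ε : P →ₗ[R] M) (hε : Function.Surjective ε) :
    (ShortComplex.mk (X₁ := ModuleCat.of R (LinearMap.ker ε))
      (ModuleCat.ofHom (LinearMap.ker ε).subtype)
      (ModuleCat.ofHom ε) (by ext x; exact x.2)).ShortExact :=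
  shortExact_of_function_exact _ _ _ (Submodule.subtype_injective _) hε
    (LinearMap.exact_subtype_ker_map ε)

/-- A resolution of length `n + 1` is a resolution of length `n` of the kernel of a surjection
from an object of `Q`. -/
lemma hasResolutionOfLength_succ_iff (Q : ObjectProperty (ModuleCat.{u} R)) (n : ℕ)
    (M : ModuleCat.{u} R) :
    HasResolutionOfLength R Q (n + 1) M ↔
      ∃ (P : ModuleCat.{u} R) (ε : P →ₗ[R] M), Q P ∧ Function.Surjective ε ∧
        HasResolutionOfLength R Q n (ModuleCat.of R (LinearMap.ker ε)) := by
  constructor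
  · rintro ⟨P, d, ε, hQ, h0, hε, hdε, hd⟩
    refine ⟨P 0, ε, hQ 0 (by lia), hε, fun k => P (k + 1), fun k => d (k + 1),
      (d 0).codRestrict _ (fun x => hdε.apply_apply_eq_zero x),
      fun k hk => hQ _ (by lia), fun k hk => h0 _ (by lia), ?_, ?_, fun k => hd (k + 1)⟩
    · rintro ⟨x, hx⟩
      obtain ⟨y, rfl⟩ := (hdε x).1 hx
      exact ⟨y, rfl⟩
    · intro x
      rw [← hd 0 x, Subtype.ext_iff]
      rfl
  · rintro ⟨P₀, ε₀, hP₀, hε₀, P, d, ε, hQ, h0, hε, hdε, hd⟩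
    refine ⟨fun k => k.casesOn P₀ P,
      fun k => match k with
        | 0 => (LinearMap.ker ε₀).subtype ∘ₗ ε
        | k + 1 => d k,
      ε₀, ?_, ?_, hε₀, ?_, ?_⟩
    · rintro (_ | k) hk
      · exact hP₀
      · exact hQ k (by lia)
    · rintro (_ | k) hk
      · lia
      · exact h0 k (by lia)
    · intro x
      constructor
      · intro hx
        obtain ⟨y, hy⟩ := hε ⟨x, hx⟩
        exact ⟨y, by simp [hy]⟩
      · rintro ⟨y, rfl⟩
        exact (ε y).2
    · rintro (_ | k)
      · intro x
        rw [← hdε x, Subtype.ext_iff]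
        rfl
      · exact hd k

lemma hasResolutionOfLength_zero_iff (Q : ObjectProperty (ModuleCat.{u} R))
    [Q.IsClosedUnderIsomorphisms] (M : ModuleCat.{u} R) :
    HasResolutionOfLength R Q 0 M ↔ Q M := by
  constructor
  · rintro ⟨P, d, ε, hQ, h0, hε, hdε, hd⟩
    have hinj : Function.Injective ε := by
      rw [injective_iff_map_eq_zero]
      intro x hx
      obtain ⟨y, rfl⟩ := (hdε x).1 hx
      have := h0 1 (by lia)
      rw [Subsingleton.elim y 0, map_zero]
    exact Q.prop_of_iso (LinearEquiv.ofBijective ε ⟨hinj, hε⟩).toModuleIso (hQ 0 le_rfl)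
  · intro hM
    refine ⟨fun k => k.casesOn M (fun _ => ModuleCat.of R PUnit), fun k => 0, LinearMap.id,
      ?_, ?_, Function.surjective_id, ?_, ?_⟩
    · rintro k hk
      obtain rfl : k = 0 := by lia
      exact hM
    · rintro (_ | k) hk
      · lia
      · exact inferInstanceAs (Subsingleton PUnit)
    · intro x
      simpa using eq_comm
    · intro k x
      have : Subsingleton (ModuleCat.of R PUnit.{u + 1}) := inferInstanceAs (Subsingleton PUnit)
      exact ⟨fun _ => ⟨0, Subsingleton.elim (α := ModuleCat.of R PUnit) _ _⟩,
        fun _ => rfl⟩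

instance : ObjectProperty.IsClosedUnderIsomorphisms
    (fun P : ModuleCat.{u} R => Module.Projective R P) where
  of_iso e _ := Module.Projective.of_equiv e.toLinearEquiv

lemma projDimLE_iff (n : ℕ) (M : ModuleCat.{u} R) :
    projDimLE R n M ↔ HasProjectiveDimensionLE M n := by
  induction n generalizing M with
  | zero =>
    rw [projDimLE, hasResolutionOfLength_zero_iff, ← projective_iff_hasProjectiveDimensionLE_zero]
    exact IsProjective.iff_projective M
  | succ n ih =>
    rw [projDimLE, hasResolutionOfLength_succ_iff]
    constructor
    · rintro ⟨P, ε, hP, hε, hK⟩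
      have : Projective P := (IsProjective.iff_projective P).1 hP
      exact ((shortExact_ker ε hε).hasProjectiveDimensionLT_X₃_iff n this).2 ((ih _).1 hK)
    · intro hM
      have hε : Function.Surjective (Projective.π M).hom :=
        (ModuleCat.epi_iff_surjective _).1 inferInstance
      refine ⟨Projective.over M, (Projective.π M).hom,
        (IsProjective.iff_projective _).2 (Projective.projective_over M), hε, (ih _).2 ?_⟩
      exact ((shortExact_ker _ hε).hasProjectiveDimensionLT_X₃_iff n
        (inferInstanceAs (Projective (Projective.over M)))).1 hM

/-- Dimension shifting along an `n`-th cosyzygy `Z` of `Y`. -/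
lemma exists_cosyzygy {C : Type u} [Category.{v} C] [Abelian C] [HasExt.{w} C]
    [EnoughInjectives C] (n : ℕ) (Y : C) : ∃ Z : C, ∀ X : C,
      Subsingleton (Ext.{w} X Y (n + 1)) ↔ Subsingleton (Ext.{w} X Z 1) := by
  induction n generalizing Y with
  | zero => exact ⟨Y, fun X => Iff.rfl⟩
  | succ n ih =>
    have hS := shortExact_of_mono (Injective.ι Y)
    obtain ⟨Z, hZ⟩ := ih (cokernel (Injective.ι Y))
    refine ⟨Z, fun X => ?_⟩
    rw [← hZ]
    constructor
    · intro h
      refine subsingleton_of_forall_eq 0 fun x => ?_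
      obtain ⟨y, hy⟩ := Ext.covariant_sequence_exact₃ X hS x rfl (h.elim _ _)
      rw [← hy, Ext.eq_zero_of_injective (I := Injective.under Y) y, Ext.zero_comp]
    · intro h
      refine subsingleton_of_forall_eq 0 fun x => ?_
      obtain ⟨y, hy⟩ := Ext.covariant_sequence_exact₁ X hS x
        (Ext.eq_zero_of_injective (I := Injective.under Y) _) rfl
      rw [← hy, h.elim y 0, Ext.zero_comp]

/-- `dw P_n` is the left orthogonal of the class of disks on the modules in `P_n^⊥`. -/
lemma dw_projDimLE_eq_leftPerp (n : ℕ) :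
    dw (projDimLE R n) = leftPerp.{u} (fun Y => ∃ (j : ℤ) (M : ModuleCat.{u} R),
      rightPerp.{u} (projDimLE R n) M ∧ Y = disk j M) := by
  ext X
  constructor
  · rintro hX _ ⟨j, M, hM, rfl⟩
    exact (subsingleton_ext_disk_iff X j M).2 (hM _ (hX j))
  · intro hX j
    rw [projDimLE_iff]
    refine hasProjectiveDimensionLT_of_enoughInjectives _ _ fun Y => ?_
    obtain ⟨Z, hZ⟩ := exists_cosyzygy.{u} n Y
    refine (hZ _).2 ((subsingleton_ext_disk_iff X j Z).1 (hX _ ⟨j, Z, fun M hM => ?_, rfl⟩))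
    rw [projDimLE_iff] at hM
    exact (hZ _).1 (HasProjectiveDimensionLT.subsingleton M (n + 1) _ le_rfl Y)

end ProjectiveDimension

/-! ### Countably generated modules -/

section CountablyGenerated

variable {R : Type u} [Ring R]

/-- Over a left noetherian ring, submodules of countably generated modules are countably
generated. -/
lemma exists_countable_span_eq_of_le [IsNoetherianRing R] {M : Type*} [AddCommGroup M]
    [Module R M] {s : Set M} (hs : s.Countable) {K : Submodule R M}
    (hK : K ≤ Submodule.span R s) : ∃ t : Set M, t.Countable ∧ Submodule.span R t = K := by
  obtain ⟨c, hc⟩ : ∃ c : ℕ → M, s ⊆ Set.range c := by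
    rcases s.eq_empty_or_nonempty with rfl | hne
    · exact ⟨fun _ => 0, Set.empty_subset _⟩
    · obtain ⟨c, rfl⟩ := hs.exists_eq_range hne
      exact ⟨c, subset_rfl⟩
  let V (n : ℕ) : Submodule R M := Submodule.span R (c '' Set.Iio n)
  have hV : Monotone V := fun i j h => Submodule.span_mono (Set.image_mono (Set.Iio_subset_Iio h))
  have hfg (n : ℕ) : (K ⊓ V n).FG := by
    have : IsNoetherian R (V n) :=
      isNoetherian_span_of_finite R ((Set.finite_Iio n).image c)
    exact (isNoetherian_submodule.1 this) _ inf_le_right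
  choose t ht using fun n => (hfg n)
  refine ⟨⋃ n, (t n : Set M), Set.countable_iUnion fun n => (t n).countable_toSet, ?_⟩
  rw [Submodule.span_iUnion]
  simp only [ht]
  refine le_antisymm (iSup_le fun n => inf_le_left) fun x hx => ?_
  have hx' : x ∈ ⨆ n, V n := by
    rw [← Submodule.span_iUnion]
    refine Submodule.span_mono ?_ (hK hx)
    intro y hy
    obtain ⟨n, rfl⟩ := hc hy
    exact Set.mem_iUnion.2 ⟨n + 1, n, by simp, rfl⟩
  obtain ⟨n, hn⟩ := (Submodule.mem_iSup_of_directed V hV.directed_le).1 hx'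
  exact (le_iSup (fun n => K ⊓ V n) n) ⟨hx, hn⟩

lemma IsCountablyGenerated.of_surjective {M N : ModuleCat.{u} R} (f : M →ₗ[R] N)
    (hf : Function.Surjective f) (hM : IsCountablyGenerated R M) : IsCountablyGenerated R N := by
  obtain ⟨s, hs, h⟩ := hM
  exact ⟨f '' s, hs.image f, by rw [Submodule.span_image, h, Submodule.map_top,
    LinearMap.range_eq_top.2 hf]⟩

lemma IsCountableSumOfCGProjective.projective {M : ModuleCat.{u} R}
    (hM : IsCountableSumOfCGProjective R M) : Module.Projective R M := by
  obtain ⟨ι, _, N, hN, ⟨e⟩⟩ := hM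
  have (i : ι) := (hN i).1
  exact Module.Projective.of_equiv e.symm

lemma IsCountableSumOfCGProjective.isCountablyGenerated {M : ModuleCat.{u} R}
    (hM : IsCountableSumOfCGProjective R M) : IsCountablyGenerated R M := by
  classical
  obtain ⟨ι, _, N, hN, ⟨e⟩⟩ := hM
  choose s hs hs' using fun i => (hN i).2
  refine ⟨e.symm '' (⋃ i, DirectSum.lof R ι (fun i => N i) i '' s i),
    (Set.countable_iUnion fun i => (hs i).image _).image _, ?_⟩
  rw [← LinearEquiv.coe_coe, Submodule.span_image, Submodule.span_iUnion]
  simp only [Submodule.span_image, hs', Submodule.map_top]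
  have : (⨆ i, LinearMap.range (DirectSum.lof R ι (fun i => N i) i)) = ⊤ :=
    DFinsupp.iSup_range_lsingle
  rw [this, Submodule.map_top, LinearEquiv.range]

lemma isCountableSumOfCGProjective_of_isCountablyGenerated {M : ModuleCat.{u} R}
    (h : Module.Projective R M) (h' : IsCountablyGenerated R M) :
    IsCountableSumOfCGProjective R M :=
  ⟨Unit, inferInstance, fun _ => M, fun _ => ⟨h, h'⟩, ⟨(DirectSum.lid R M).symm⟩⟩

lemma projDimLEAleph0_le_projDimLE (n : ℕ) : projDimLEAleph0 R n ≤ projDimLE R n := by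
  rintro M ⟨P, d, ε, hQ, h⟩
  exact ⟨P, d, ε, fun k hk => (hQ k hk).projective, h⟩

lemma IsCountablyGenerated.of_projDimLEAleph0 {n : ℕ} {M : ModuleCat.{u} R}
    (hM : projDimLEAleph0 R n M) : IsCountablyGenerated R M := by
  obtain ⟨P, d, ε, hQ, -, hε, -⟩ := hM
  exact .of_surjective ε hε (hQ 0 (Nat.zero_le n)).isCountablyGenerated

lemma IsCountablyGenerated.exists_linearEquiv {M : ModuleCat.{u} R}
    (hM : IsCountablyGenerated R M) :
    ∃ K : Submodule R (ℕ →₀ R), Nonempty (((ℕ →₀ R) ⧸ K) ≃ₗ[R] M) := by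
  obtain ⟨s, hs, h⟩ := hM
  have hne : (insert 0 s).Nonempty := Set.insert_nonempty _ _
  obtain ⟨c, hc⟩ := (hs.insert 0).exists_eq_range hne
  have hsurj : Function.Surjective (Finsupp.linearCombination R c) := by
    rw [← LinearMap.range_eq_top, Finsupp.range_linearCombination, ← hc, eq_top_iff, ← h]
    exact Submodule.span_mono (Set.subset_insert _ _)
  exact ⟨_, ⟨LinearMap.quotKerEquivOfSurjective _ hsurj⟩⟩

/-- Every countably generated module is isomorphic to a quotient of `R^(ℕ)`, so a complex of such
modules is isomorphic to one described by a family of submodules of `R^(ℕ)` and linear maps between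
the quotients. -/
lemma essentiallySmall_dw {A : ObjectProperty (ModuleCat.{u} R)}
    (hA : ∀ M, A M → IsCountablyGenerated R M) : ObjectProperty.EssentiallySmall.{u} (dw A) := by
  let D : Type u := Σ K : ℤ → Submodule R (ℕ →₀ R),
    {d : ∀ i j, ((ℕ →₀ R) ⧸ K i) →ₗ[R] ((ℕ →₀ R) ⧸ K j) //
      (∀ i j, ¬ (ComplexShape.down ℤ).Rel i j → d i j = 0) ∧
      ∀ i j k, d j k ∘ₗ d i j = 0}
  let G (x : D) : ChainComplex (ModuleCat.{u} R) ℤ :=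
    { X i := ModuleCat.of R ((ℕ →₀ R) ⧸ x.1 i)
      d i j := ModuleCat.ofHom (x.2.1 i j)
      shape i j h := by rw [x.2.2.1 i j h]; rfl
      d_comp_d' i j k _ _ := by rw [← ModuleCat.ofHom_comp, x.2.2.2]; rfl }
  refine ⟨.ofObj G, inferInstance, fun X hX => ?_⟩
  choose K e using fun i => (hA _ (hX i)).exists_linearEquiv
  let e (i : ℤ) := (e i).some
  refine ⟨G ⟨K, fun i j => (e j).symm.toLinearMap ∘ₗ (X.d i j).hom ∘ₗ (e i).toLinearMap, ?_, ?_⟩,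
    ⟨_⟩, ⟨HomologicalComplex.Hom.isoOfComponents (fun i => (e i).symm.toModuleIso) ?_⟩⟩
  · intro i j h
    ext x
    simp [X.shape i j h]
  · intro i j k
    ext x
    simp [← ModuleCat.comp_apply]
  · intro i j _
    ext x
    simp [G]

end CountablyGenerated

/-! ### Closure conditions of countable character -/

section ClosureConditions

lemma exists_countable_family_eq {A : Type*} {M : A → Type*} {a : A} {S : Set (M a)}
    (hS : S.Countable) :
    ∃ C : ∀ b, Set (M b), (∀ b, (C b).Countable) ∧ C a = S := by
  classical
  refine ⟨Function.update (fun _ => ∅) a S, fun b => ?_, Function.update_self _ _ _⟩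
  by_cases h : b = a
  · subst h
    rwa [Function.update_self]
  · rw [Function.update_of_ne h]
    exact Set.countable_empty

variable {R : Type u} [Ring R] {A : Type*} {M : A → Type*} [∀ a, AddCommGroup (M a)]
  [∀ a, Module R (M a)]

/-- The family of submodules generated by a family of subsets. -/
def spanFamily (C : ∀ a, Set (M a)) : ∀ a, Submodule R (M a) := fun a => Submodule.span R (C a)

lemma spanFamily_mono {C C' : ∀ a, Set (M a)} (h : ∀ a, C a ⊆ C' a) :
    spanFamily (R := R) C ≤ spanFamily C' := fun a => Submodule.span_mono (h a)

lemma mem_sSup_family {𝒮 : Set (∀ a, Submodule R (M a))} (hne : 𝒮.Nonempty)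
    (hdir : DirectedOn (· ≤ ·) 𝒮) {a : A} {x : M a} :
    x ∈ (sSup 𝒮) a ↔ ∃ Q ∈ 𝒮, x ∈ Q a := by
  have := hne.to_subtype
  rw [sSup_apply, Submodule.mem_iSup_of_directed]
  · simp
  · exact hdir.directed_val.mono_comp _ (fun Q Q' h => h a)

/-- A relation `T Q Q'` between families of submodules, read as "what `Q` demands is supplied by
`Q'`", is a finitary closure condition of countable character if it is monotone in `Q'`, if the
demands of a directed union are those of its members, if the zero family supplies its own demands,
and if over a family satisfying `T Q Q` any countable number of additional elements leads to only
countably many additional demands. -/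
structure IsClosureCondition
    (T : (∀ a, Submodule R (M a)) → (∀ a, Submodule R (M a)) → Prop) : Prop where
  mono : ∀ Q Q₁ Q₂, Q₁ ≤ Q₂ → T Q Q₁ → T Q Q₂
  sSup : ∀ (𝒮 : Set (∀ a, Submodule R (M a))) (Q' : ∀ a, Submodule R (M a)), 𝒮.Nonempty →
    DirectedOn (· ≤ ·) 𝒮 → (∀ Q ∈ 𝒮, T Q Q') → T (sSup 𝒮) Q'
  bot : T ⊥ ⊥
  extend : ∀ Q, T Q Q → ∀ C : ∀ a, Set (M a), (∀ a, (C a).Countable) →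
    ∃ C' : ∀ a, Set (M a), (∀ a, (C' a).Countable) ∧ T (Q ⊔ spanFamily C) (Q ⊔ spanFamily C')

namespace IsClosureCondition

variable {T : (∀ a, Submodule R (M a)) → (∀ a, Submodule R (M a)) → Prop}

lemma sSup_closed (hT : IsClosureCondition T) {𝒮 : Set (∀ a, Submodule R (M a))}
    (hne : 𝒮.Nonempty) (hdir : DirectedOn (· ≤ ·) 𝒮) (h : ∀ Q ∈ 𝒮, T Q Q) :
    T (SupSet.sSup 𝒮) (SupSet.sSup 𝒮) :=
  hT.sSup 𝒮 _ hne hdir fun Q hQ => hT.mono _ _ _ (le_sSup hQ) (h Q hQ)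

/-- The closure is reached after countably many rounds of supplying what is demanded. -/
lemma exists_closed_extension (hT : IsClosureCondition T) {Q : ∀ a, Submodule R (M a)}
    (hQ : T Q Q) {C : ∀ a, Set (M a)} (hC : ∀ a, (C a).Countable) :
    ∃ C' : ∀ a, Set (M a), (∀ a, (C' a).Countable) ∧ (∀ a, C a ⊆ C' a) ∧
      T (Q ⊔ spanFamily C') (Q ⊔ spanFamily C') := by
  choose! E hE hTE using hT.extend Q hQ
  let D : ℕ → ∀ a, Set (M a) := fun i => i.rec C (fun _ B a => B a ∪ E B a)
  have hD (i : ℕ) : ∀ a, (D i a).Countable := by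
    induction i with
    | zero => exact hC
    | succ i ih => exact fun a => (ih a).union (hE _ ih a)
  have hmono : Monotone D := monotone_nat_of_le_succ fun i a => Set.subset_union_left
  let D' : ∀ a, Set (M a) := fun a => ⋃ i, D i a
  have hsup : Q ⊔ spanFamily D' = SupSet.sSup (Set.range fun i => Q ⊔ spanFamily (D i)) := by
    rw [sSup_range, ← sup_iSup]
    congr 1
    funext a
    simp only [iSup_apply, spanFamily, D', Submodule.span_iUnion]
  refine ⟨D', fun a => Set.countable_iUnion fun i => hD i a,
    fun a => Set.subset_iUnion (fun i => D i a) 0, ?_⟩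
  conv => arg 1; rw [hsup]
  refine hT.sSup _ _ (Set.range_nonempty _) ?_ ?_
  · refine directedOn_range.2 (Monotone.directed_le fun i j h => ?_)
    exact sup_le_sup_left (spanFamily_mono (hmono h)) _
  · rintro _ ⟨i, rfl⟩
    refine hT.mono _ _ _ (sup_le_sup_left (spanFamily_mono fun a => ?_) _) (hTE (D i) (hD i))
    exact Set.subset_union_right.trans (Set.subset_iUnion (fun i => D i a) (i + 1))

lemma and {T₁ T₂ : (∀ a, Submodule R (M a)) → (∀ a, Submodule R (M a)) → Prop}
    (h₁ : IsClosureCondition T₁) (h₂ : IsClosureCondition T₂) :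
    IsClosureCondition fun Q Q' => T₁ Q Q' ∧ T₂ Q Q' where
  mono Q Q₁ Q₂ h := And.imp (h₁.mono _ _ _ h) (h₂.mono _ _ _ h)
  sSup 𝒮 Q' hne hdir h :=
    ⟨h₁.sSup 𝒮 Q' hne hdir fun Q hQ => (h Q hQ).1, h₂.sSup 𝒮 Q' hne hdir fun Q hQ => (h Q hQ).2⟩
  bot := ⟨h₁.bot, h₂.bot⟩
  extend Q hQ C hC := by
    obtain ⟨C₁, hC₁, hT₁⟩ := h₁.extend Q hQ.1 C hC
    obtain ⟨C₂, hC₂, hT₂⟩ := h₂.extend Q hQ.2 C hC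
    exact ⟨fun a => C₁ a ∪ C₂ a, fun a => (hC₁ a).union (hC₂ a),
      h₁.mono _ _ _ (sup_le_sup_left (spanFamily_mono fun a => Set.subset_union_left) _) hT₁,
      h₂.mono _ _ _ (sup_le_sup_left (spanFamily_mono fun a => Set.subset_union_right) _) hT₂⟩

lemma forall_countable {ι : Type*} [Countable ι]
    {T : ι → (∀ a, Submodule R (M a)) → (∀ a, Submodule R (M a)) → Prop}
    (h : ∀ i, IsClosureCondition (T i)) :
    IsClosureCondition fun Q Q' => ∀ i, T i Q Q' where
  mono Q Q₁ Q₂ hle hT i := (h i).mono _ _ _ hle (hT i)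
  sSup 𝒮 Q' hne hdir hT i := (h i).sSup 𝒮 Q' hne hdir fun Q hQ => hT Q hQ i
  bot i := (h i).bot
  extend Q hQ C hC := by
    choose C' hC' hT using fun i => (h i).extend Q (hQ i) C hC
    refine ⟨fun a => ⋃ i, C' i a, fun a => Set.countable_iUnion fun i => hC' i a, fun i => ?_⟩
    exact (h i).mono _ _ _ (sup_le_sup_left
      (spanFamily_mono fun a => Set.subset_iUnion (fun i => C' i a) i) _) (hT i)

end IsClosureCondition

lemma isClosureCondition_map {a b : A} (f : M a →ₗ[R] M b) :
    IsClosureCondition fun Q Q' : ∀ a, Submodule R (M a) => Q a ≤ (Q' b).comap f where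
  mono Q Q₁ Q₂ h hT := hT.trans (Submodule.comap_mono (h b))
  sSup 𝒮 Q' hne hdir h x hx := by
    obtain ⟨Q, hQ, hxQ⟩ := (mem_sSup_family hne hdir).1 hx
    exact h Q hQ hxQ
  bot := bot_le
  extend Q hQ C hC := by
    obtain ⟨C', hC', hb⟩ := exists_countable_family_eq ((hC a).image f)
    refine ⟨C', hC', sup_le (hQ.trans (Submodule.comap_mono le_sup_left)) ?_⟩
    refine Submodule.span_le.2 fun x hx => ?_
    refine Submodule.mem_sup_right (Submodule.subset_span ?_)
    rw [hb]
    exact ⟨x, hx, rfl⟩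

/-- The condition that elements of `Q b` in the range of `f` have preimages in `Q a`. Here the
noetherian hypothesis is needed: infinitely many elements may have to be lifted, but they form part
of a submodule of a countably generated module. -/
lemma isClosureCondition_lift [IsNoetherianRing R] {a b : A} (f : M a →ₗ[R] M b) :
    IsClosureCondition fun Q Q' : ∀ a, Submodule R (M a) =>
      Q b ⊓ LinearMap.range f ≤ (Q' a).map f where
  mono Q Q₁ Q₂ h hT := hT.trans (Submodule.map_mono (h a))
  sSup 𝒮 Q' hne hdir h x hx := by
    obtain ⟨Q, hQ, hxQ⟩ := (mem_sSup_family hne hdir).1 hx.1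
    exact h Q hQ ⟨hxQ, hx.2⟩
  bot := inf_le_left.trans bot_le
  extend Q hQ C hC := by
    obtain ⟨t, ht, hspan⟩ := exists_countable_span_eq_of_le (hC b)
      (inf_le_left : Submodule.span R (C b) ⊓ (Q b ⊔ LinearMap.range f) ≤ _)
    have hmem (g : M b) (hg : g ∈ t) : ∃ y : M a, g - f y ∈ Q b := by
      have : g ∈ Submodule.span R (C b) ⊓ (Q b ⊔ LinearMap.range f) := by
        rw [← hspan]
        exact Submodule.subset_span hg
      obtain ⟨q, hq, _, ⟨y, rfl⟩, h⟩ := Submodule.mem_sup.1 this.2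
      exact ⟨y, by rwa [← h, add_sub_cancel_right]⟩
    choose! y hy using hmem
    obtain ⟨C', hC', ha⟩ := exists_countable_family_eq (ht.image y)
    refine ⟨C', hC', ?_⟩
    have key : Submodule.span R t ≤ Q b ⊔ (Submodule.span R (C' a)).map f := by
      refine Submodule.span_le.2 fun g hg => ?_
      rw [← sub_add_cancel g (f (y g))]
      refine add_mem (Submodule.mem_sup_left (hy g hg)) (Submodule.mem_sup_right ?_)
      refine Submodule.mem_map_of_mem (Submodule.subset_span ?_)
      rw [ha]
      exact ⟨g, hg, rfl⟩
    rintro x ⟨hx, hxf⟩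
    obtain ⟨q, hq, c, hc, rfl⟩ := Submodule.mem_sup.1 hx
    have hct : c ∈ Submodule.span R t := by
      rw [hspan]
      refine ⟨hc, ?_⟩
      rw [← add_sub_cancel_left q c]
      exact sub_mem (Submodule.mem_sup_right hxf) (Submodule.mem_sup_left hq)
    obtain ⟨q', hq', _, ⟨z, hz, rfl⟩, rfl⟩ := Submodule.mem_sup.1 (key hct)
    have hqq : q + q' ∈ Q b ⊓ LinearMap.range f := by
      refine ⟨add_mem hq hq', ?_⟩
      have := sub_mem hxf (LinearMap.mem_range_self f z)
      rwa [← add_assoc, add_sub_cancel_right] at this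
    obtain ⟨p, hp, hpq⟩ := hQ hqq
    refine ⟨p + z, add_mem (Submodule.mem_sup_left hp) (Submodule.mem_sup_right hz), ?_⟩
    rw [map_add, hpq, add_assoc]

/-- The condition that the coefficients of `s`, for a section `s` of the canonical surjection
`R^(P) ⟶ P`, are supported in `Q a` on elements of `Q a`. -/
lemma isClosureCondition_support {a : A} (s : M a →ₗ[R] (M a →₀ R)) :
    IsClosureCondition fun Q Q' : ∀ a, Submodule R (M a) =>
      Q a ≤ (Finsupp.supported R R (Q' a : Set (M a))).comap s where
  mono Q Q₁ Q₂ h hT := hT.trans (Submodule.comap_mono (Finsupp.supported_mono (h a)))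
  sSup 𝒮 Q' hne hdir h x hx := by
    obtain ⟨Q, hQ, hxQ⟩ := (mem_sSup_family hne hdir).1 hx
    exact h Q hQ hxQ
  bot := bot_le
  extend Q hQ C hC := by
    obtain ⟨C', hC', ha⟩ := exists_countable_family_eq
      ((hC a).biUnion fun c _ => (s c).support.countable_toSet)
    refine ⟨C', hC', sup_le (hQ.trans (Submodule.comap_mono (Finsupp.supported_mono ?_))) ?_⟩
    · exact fun x hx => Submodule.mem_sup_left hx
    · refine Submodule.span_le.2 fun x hx p hp => ?_
      refine Submodule.mem_sup_right (Submodule.subset_span ?_)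
      rw [ha]
      exact Set.mem_biUnion hx hp

end ClosureConditions

/-! ### Quotients of nested families of submodules -/

section RelativeQuotients

variable {R : Type u} [Ring R]

/-- The map `N₁' / N₁ ⟶ N₂' / N₂` induced by `f`, for submodules `N₁ ≤ N₁'` of the source and
`N₂ ≤ N₂'` of the target. -/
def quotientMap {M₁ M₂ : Type*} [AddCommGroup M₁] [AddCommGroup M₂] [Module R M₁] [Module R M₂]
    (f : M₁ →ₗ[R] M₂) {N₁ N₁' : Submodule R M₁} {N₂ N₂' : Submodule R M₂}
    (h : N₁ ≤ N₂.comap f) (h' : N₁' ≤ N₂'.comap f) :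
    (N₁' ⧸ N₁.comap N₁'.subtype) →ₗ[R] (N₂' ⧸ N₂.comap N₂'.subtype) :=
  Submodule.mapQ _ _ (f.restrict h') fun _ hx => h hx

lemma quotientMap_mk {M₁ M₂ : Type*} [AddCommGroup M₁] [AddCommGroup M₂] [Module R M₁]
    [Module R M₂] (f : M₁ →ₗ[R] M₂) {N₁ N₁' : Submodule R M₁} {N₂ N₂' : Submodule R M₂}
    (h : N₁ ≤ N₂.comap f) (h' : N₁' ≤ N₂'.comap f) (x : N₁') :
    quotientMap f h h' (Submodule.Quotient.mk x) = Submodule.Quotient.mk ⟨f x, h' x.2⟩ := rfl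

lemma quotientMap_surjective {M₁ M₂ : Type*} [AddCommGroup M₁] [AddCommGroup M₂] [Module R M₁]
    [Module R M₂] (f : M₁ →ₗ[R] M₂) {N₁ N₁' : Submodule R M₁} {N₂ N₂' : Submodule R M₂}
    (h : N₁ ≤ N₂.comap f) (h' : N₁' ≤ N₂'.comap f) (hf : Function.Surjective f)
    (hl : N₂' ⊓ LinearMap.range f ≤ N₁'.map f) :
    Function.Surjective (quotientMap f h h') := by
  intro y
  obtain ⟨⟨y, hy⟩, rfl⟩ := Submodule.Quotient.mk_surjective _ y
  obtain ⟨x, hx, rfl⟩ := hl ⟨hy, hf y⟩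
  exact ⟨Submodule.Quotient.mk ⟨x, hx⟩, rfl⟩

/-- If `M₁ ⟶ M₂ ⟶ M₃` is exact and the families `N ≤ N'` of submodules admit the indicated
lifts, then `N' / N` is exact at the middle term. -/
lemma quotientMap_exact {M₁ M₂ M₃ : Type*} [AddCommGroup M₁] [AddCommGroup M₂] [AddCommGroup M₃]
    [Module R M₁] [Module R M₂] [Module R M₃] (f : M₁ →ₗ[R] M₂) (g : M₂ →ₗ[R] M₃)
    {N₁ N₁' : Submodule R M₁} {N₂ N₂' : Submodule R M₂} {N₃ N₃' : Submodule R M₃}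
    (h₁ : N₁ ≤ N₂.comap f) (h₁' : N₁' ≤ N₂'.comap f) (h₂ : N₂ ≤ N₃.comap g)
    (h₂' : N₂' ≤ N₃'.comap g) (hle : N₂ ≤ N₂') (hfg : Function.Exact f g)
    (hl : N₂' ⊓ LinearMap.range f ≤ N₁'.map f) (hl' : N₃ ⊓ LinearMap.range g ≤ N₂.map g) :
    Function.Exact (quotientMap f h₁ h₁') (quotientMap g h₂ h₂') := by
  intro x
  obtain ⟨⟨x, hx⟩, rfl⟩ := Submodule.Quotient.mk_surjective _ x
  constructor
  · intro h0
    rw [quotientMap_mk, Submodule.Quotient.mk_eq_zero] at h0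
    have hgx : g x ∈ N₃ := h0
    obtain ⟨y, hy, hyx⟩ := hl' ⟨hgx, LinearMap.mem_range_self _ _⟩
    have hker : g (x - y) = 0 := by rw [map_sub, hyx, sub_self]
    obtain ⟨z, hz, hzx⟩ := hl ⟨sub_mem hx (hle hy), (hfg _).1 hker⟩
    refine ⟨Submodule.Quotient.mk ⟨z, hz⟩, (Submodule.Quotient.eq _).2 ?_⟩
    change f z - x ∈ N₂
    rw [hzx, sub_sub_cancel_left]
    exact neg_mem hy
  · rintro ⟨z, hz⟩
    obtain ⟨⟨z, hz'⟩, rfl⟩ := Submodule.Quotient.mk_surjective _ z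
    rw [← hz]
    refine (Submodule.Quotient.mk_eq_zero _).2 ?_
    change g (f z) ∈ N₃
    rw [hfg.apply_apply_eq_zero]
    exact zero_mem _

open Classical in
/-- If `N ≤ N'` are submodules of `P` on which a section `s` of `R^(P) ⟶ P` has coefficients
supported in `N` and `N'` respectively, then `N' / N` is a direct summand of a free module: the
map induced by `s`, with the coefficients at elements of `N` discarded, is split by evaluation. -/
lemma projective_quotient {P : Type u} [AddCommGroup P] [Module R P] (s : P →ₗ[R] (P →₀ R))
    (hs : ∀ x, Finsupp.linearCombination R id (s x) = x) {N N' : Submodule R P}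
    (hN : N ≤ (Finsupp.supported R R (N : Set P)).comap s)
    (hN' : N' ≤ (Finsupp.supported R R (N' : Set P)).comap s) :
    Module.Projective R (N' ⧸ N.comap N'.subtype) := by
  let r : (P →₀ R) →ₗ[R] (P →₀ R) :=
    (Finsupp.supported R R ((N : Set P)ᶜ)).subtype ∘ₗ Finsupp.restrictDom R R _
  have hr (v : P →₀ R) (p : P) : r v p = if p ∈ N then 0 else v p := by
    simp [r, Finsupp.filter_apply]
  let σ : (N' ⧸ N.comap N'.subtype) →ₗ[R] (P →₀ R) :=
    Submodule.liftQ _ (r ∘ₗ s ∘ₗ N'.subtype) <| by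
      intro x hx
      rw [LinearMap.mem_ker]
      ext p
      have h0 : p ∉ N → s x p = 0 := fun hp =>
        Finsupp.notMem_support_iff.1 fun h => hp (hN hx h)
      simpa [hr] using h0
  let φ : P → N' ⧸ N.comap N'.subtype := fun p =>
    if h : p ∈ N' then Submodule.Quotient.mk ⟨p, h⟩ else 0
  have hφ (p : P) (hp : p ∈ N) : φ p = 0 := by
    by_cases h : p ∈ N'
    · simp only [φ, dif_pos h]
      exact (Submodule.Quotient.mk_eq_zero _).2 hp
    · simp only [φ, dif_neg h]
  refine Module.Projective.of_split σ (Finsupp.linearCombination R φ) (LinearMap.ext fun x => ?_)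
  obtain ⟨⟨x, hx⟩, rfl⟩ := Submodule.Quotient.mk_surjective _ x
  have h₁ : Finsupp.linearCombination R φ (r (s x)) = Finsupp.linearCombination R φ (s x) := by
    rw [Finsupp.linearCombination_apply, Finsupp.linearCombination_apply,
      Finsupp.sum_of_support_subset (s := (s x).support), Finsupp.sum]
    · refine Finset.sum_congr rfl fun p _ => ?_
      rw [hr]
      split_ifs with hp
      · rw [hφ p hp, smul_zero, smul_zero]
      · rfl
    · intro p hp
      rw [Finsupp.mem_support_iff, hr] at hp
      rw [Finsupp.mem_support_iff]
      intro h
      simp [h] at hp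
    · simp
  -- on coefficients supported in `N'`, evaluation along `φ` is evaluation followed by projection
  have h₂ (v : P →₀ R) (hv : v ∈ Finsupp.supported R R (N' : Set P)) :
      ∃ h : Finsupp.linearCombination R id v ∈ N',
        Finsupp.linearCombination R φ v = Submodule.Quotient.mk ⟨_, h⟩ := by
    rw [Finsupp.supported_eq_span_single] at hv
    induction hv using Submodule.span_induction with
    | mem v hv =>
      obtain ⟨p, hp, rfl⟩ := hv
      refine ⟨by simpa using hp, ?_⟩
      simp only [Finsupp.linearCombination_single, one_smul, id, φ]
      exact dif_pos hp
    | zero => exact ⟨by simp, by simp only [map_zero]; rfl⟩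
    | add v w _ _ hv hw =>
      obtain ⟨hv, hv'⟩ := hv
      obtain ⟨hw, hw'⟩ := hw
      refine ⟨by rw [map_add]; exact add_mem hv hw, ?_⟩
      simp only [map_add, hv', hw']
      rfl
    | smul c v _ hv =>
      obtain ⟨hv, hv'⟩ := hv
      refine ⟨by rw [map_smul]; exact N'.smul_mem c hv, ?_⟩
      simp only [map_smul, hv']
      rfl
  obtain ⟨h, h'⟩ := h₂ (s x) (hN' hx)
  change Finsupp.linearCombination R φ (r (s x)) = _
  rw [h₁, h']
  simp only [hs]
  rfl

lemma isCountablyGenerated_quotient {P : Type u} [AddCommGroup P] [Module R P]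
    (N : Submodule R P) {C : Set P} (hC : C.Countable) :
    IsCountablyGenerated R (ModuleCat.of R (↥(N ⊔ Submodule.span R C) ⧸
      N.comap (N ⊔ Submodule.span R C).subtype)) := by
  set N' := N ⊔ Submodule.span R C with hN'
  let π : N' →ₗ[R] (N' ⧸ N.comap N'.subtype) := Submodule.mkQ _
  refine ⟨π '' (Subtype.val ⁻¹' C), (hC.preimage Subtype.val_injective).image _, ?_⟩
  rw [eq_top_iff]
  rintro x -
  obtain ⟨⟨x, hx⟩, rfl⟩ := Submodule.Quotient.mk_surjective _ x
  obtain ⟨q, hq, c, hc, rfl⟩ := Submodule.mem_sup.1 hx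
  have hq' : q ∈ N' := Submodule.mem_sup_left hq
  have hle : Submodule.span R C ≤ N' := le_sup_right
  have e : (Submodule.Quotient.mk ⟨q + c, hx⟩ : N' ⧸ N.comap N'.subtype) = π ⟨c, hle hc⟩ := by
    refine (Submodule.Quotient.eq _).2 ?_
    change q + c - c ∈ N
    rwa [add_sub_cancel_right]
  rw [e, ← Submodule.map_span]
  refine Submodule.mem_map_of_mem ?_
  have : (Submodule.span R (Subtype.val ⁻¹' C : Set N')).map N'.subtype = Submodule.span R C := by
    rw [Submodule.map_span]
    congr 1
    ext y
    exact ⟨by rintro ⟨z, hz, rfl⟩; exact hz,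
      fun hy => ⟨⟨y, hle (Submodule.subset_span hy)⟩, hy, rfl⟩⟩
  have hc' := hc
  rw [← this] at hc'
  obtain ⟨z, hz, hzc⟩ := hc'
  rwa [show (⟨c, hle hc⟩ : N') = z from Subtype.ext hzc.symm]

end RelativeQuotients

/-! ### Subcomplexes of degreewise resolutions -/

section ResolvedComplexes

variable {R : Type u} [Ring R]

/-- Degreewise projective resolutions of length `n` of a complex `X` (not related by the
differential of `X`), with a section `s` of the canonical surjection `R^(P) ⟶ P` for each
term `P`. -/
structure Resolved (n : ℕ) (X : ChainComplex (ModuleCat.{u} R) ℤ) where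
  P : ℤ → ℕ → ModuleCat.{u} R
  d : ∀ m k, P m (k + 1) →ₗ[R] P m k
  ε : ∀ m, P m 0 →ₗ[R] X.X m
  s : ∀ m k, P m k →ₗ[R] (P m k →₀ R)
  subsingleton : ∀ m, ∀ k > n, Subsingleton (P m k)
  surjective : ∀ m, Function.Surjective (ε m)
  exact_ε : ∀ m, Function.Exact (d m 0) (ε m)
  exact_d : ∀ m k, Function.Exact (d m (k + 1)) (d m k)
  linearCombination_s : ∀ m k x, Finsupp.linearCombination R id (s m k x) = x

lemma nonempty_resolved {n : ℕ} {X : ChainComplex (ModuleCat.{u} R) ℤ}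
    (hX : dw (projDimLE R n) X) : Nonempty (Resolved n X) := by
  choose P d ε hP h0 hε hdε hd using hX
  have hproj (m : ℤ) (k : ℕ) : Module.Projective R (P m k) := by
    by_cases hk : k ≤ n
    · exact hP m k hk
    · have := h0 m k (not_le.1 hk)
      have := Module.Free.of_subsingleton R (P m k)
      exact Module.Projective.of_free
  choose s hs using fun m k => (hproj m k).out
  exact ⟨⟨P, d, ε, s, h0, hε, hdε, hd, hs⟩⟩

namespace Resolved

variable {n : ℕ} {X : ChainComplex (ModuleCat.{u} R) ℤ} (𝒳 : Resolved n X)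

/-- The terms of the augmented resolutions: `X m` at `(m, 0)` and `P m k` at `(m, k + 1)`. -/
def term : ℤ × ℕ → ModuleCat.{u} R
  | (m, 0) => X.X m
  | (m, k + 1) => 𝒳.P m k

/-- The maps of the augmented resolutions. -/
def δ (m : ℤ) : ∀ k : ℕ, 𝒳.term (m, k + 1) →ₗ[R] 𝒳.term (m, k)
  | 0 => 𝒳.ε m
  | k + 1 => 𝒳.d m k

/-- The chosen section of `R^(P) ⟶ P`, on a term `P` of the augmented resolutions. -/
def coeffs (m : ℤ) (k : ℕ) : 𝒳.term (m, k + 1) →ₗ[R] (𝒳.term (m, k + 1) →₀ R) := 𝒳.s m k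

/-- The differential of `X`, as a map between terms of the augmented resolutions. -/
def diff (i j : ℤ) : 𝒳.term (i, 0) →ₗ[R] 𝒳.term (j, 0) := (X.d i j).hom

/-- Families of submodules of the terms of the augmented resolutions. -/
abbrev Family := ∀ a, Submodule R (𝒳.term a)

/-- `Q'` contains the image of `Q` under all maps in sight, has preimages for the boundaries in
`Q`, and contains the supports of the coefficients of elements of `Q`. -/
def Supplies (Q Q' : 𝒳.Family) : Prop :=
  (∀ p : ℤ × ℤ, Q (p.1, 0) ≤ (Q' (p.2, 0)).comap (𝒳.diff p.1 p.2)) ∧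
  (∀ p : ℤ × ℕ, Q (p.1, p.2 + 1) ≤ (Q' (p.1, p.2)).comap (𝒳.δ p.1 p.2)) ∧
  (∀ p : ℤ × ℕ, Q (p.1, p.2) ⊓ LinearMap.range (𝒳.δ p.1 p.2) ≤
    (Q' (p.1, p.2 + 1)).map (𝒳.δ p.1 p.2)) ∧
  (∀ p : ℤ × ℕ, Q (p.1, p.2 + 1) ≤
    (Finsupp.supported R R (Q' (p.1, p.2 + 1) : Set (𝒳.term (p.1, p.2 + 1)))).comap
      (𝒳.coeffs p.1 p.2))

/-- A family of submodules which is a subcomplex of the augmented resolutions over a subcomplex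
of `X`, whose rows are again exact and whose quotients of nested pairs consist of projective
modules. -/
def IsGood (Q : 𝒳.Family) : Prop := 𝒳.Supplies Q Q

lemma isClosureCondition_supplies [IsNoetherianRing R] : IsClosureCondition 𝒳.Supplies :=
  .and (.forall_countable fun _ => isClosureCondition_map _)
    (.and (.forall_countable fun _ => isClosureCondition_map _)
      (.and (.forall_countable fun _ => isClosureCondition_lift _)
        (.forall_countable fun _ => isClosureCondition_support _)))

variable {𝒳}

/-- The subcomplex of `X` underlying a good family. -/
def IsGood.sub {Q : 𝒳.Family} (hQ : 𝒳.IsGood Q) : Subcomplex X where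
  carrier m := Q (m, 0)
  d_mem i j _ hx := hQ.1 (i, j) hx

lemma IsGood.exact {Q Q' : 𝒳.Family} (hQ : 𝒳.IsGood Q) (hQ' : 𝒳.IsGood Q') (hle : Q ≤ Q')
    (m : ℤ) (k : ℕ) : Function.Exact
      (quotientMap (𝒳.δ m (k + 1)) (hQ.2.1 (m, k + 1)) (hQ'.2.1 (m, k + 1)))
      (quotientMap (𝒳.δ m k) (hQ.2.1 (m, k)) (hQ'.2.1 (m, k))) := by
  refine quotientMap_exact _ _ _ _ _ _ (hle _) ?_ (hQ'.2.2.1 (m, k + 1)) (hQ.2.2.1 (m, k))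
  cases k with
  | zero => exact 𝒳.exact_ε m
  | succ k => exact 𝒳.exact_d m k

/-- The quotient of a good family by a smaller one, from which it arises by adjoining countably
many generators, resolves the quotient of the underlying subcomplexes. -/
lemma IsGood.dw_quotient {Q Q' : 𝒳.Family} (hQ : 𝒳.IsGood Q) (hQ' : 𝒳.IsGood Q')
    {C : ∀ a, Set (𝒳.term a)} (hC : ∀ a, (C a).Countable) (h : Q' = Q ⊔ spanFamily C) :
    dw (projDimLEAleph0 R n) (hQ'.sub.quotient hQ.sub) := by
  have hle : Q ≤ Q' := h ▸ le_sup_left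
  intro m
  refine ⟨fun k => ModuleCat.of R
      (Q' (m, k + 1) ⧸ (Q (m, k + 1)).comap (Q' (m, k + 1)).subtype),
    fun k => quotientMap (𝒳.δ m (k + 1)) (hQ.2.1 (m, k + 1)) (hQ'.2.1 (m, k + 1)),
    quotientMap (𝒳.δ m 0) (hQ.2.1 (m, 0)) (hQ'.2.1 (m, 0)), fun k _ => ?_, fun k hk => ?_, ?_,
    hQ.exact hQ' hle m 0, fun k => hQ.exact hQ' hle m (k + 1)⟩
  · refine isCountableSumOfCGProjective_of_isCountablyGenerated ?_ ?_
    · exact projective_quotient (𝒳.coeffs m k) (𝒳.linearCombination_s m k)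
        (hQ.2.2.2 (m, k)) (hQ'.2.2.2 (m, k))
    · subst h
      exact isCountablyGenerated_quotient _ (hC _)
  · have : Subsingleton (𝒳.term (m, k + 1)) := 𝒳.subsingleton m k hk
    exact (Submodule.Quotient.mk_surjective
      ((Q (m, k + 1)).comap (Q' (m, k + 1)).subtype)).subsingleton
  · exact quotientMap_surjective _ _ _ (𝒳.surjective m) (hQ'.2.2.1 (m, 0))

/-- A good family can be enlarged to a good family containing a given countable set of elements
of `X`, with quotient in `dw P_n^ℵ₀`. -/
lemma IsGood.exists_extension [IsNoetherianRing R] {Q : 𝒳.Family} (hQ : 𝒳.IsGood Q)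
    {c : ∀ m, Set (X.X m)} (hc : ∀ m, (c m).Countable) :
    ∃ (Q' : 𝒳.Family) (hQ' : 𝒳.IsGood Q'), Q ≤ Q' ∧ (∀ m, ∀ x ∈ c m, x ∈ Q' (m, 0)) ∧
      dw (projDimLEAleph0 R n) (hQ'.sub.quotient hQ.sub) := by
  let C : ∀ a, Set (𝒳.term a) := fun
    | (m, 0) => c m
    | (_, _ + 1) => ∅
  have hC (a) : (C a).Countable := match a with
    | (m, 0) => hc m
    | (_, _ + 1) => Set.countable_empty
  obtain ⟨C', hC', hle, hgood⟩ := 𝒳.isClosureCondition_supplies.exists_closed_extension hQ hC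
  exact ⟨Q ⊔ spanFamily C', hgood, le_sup_left,
    fun m x hx => (le_sup_right : spanFamily C' ≤ Q ⊔ spanFamily C') (m, 0)
      (Submodule.subset_span (hle (m, 0) hx)),
    hQ.dw_quotient hgood hC' rfl⟩

end Resolved

end ResolvedComplexes

/-! ### The filtration -/

section Filtration

/-- Transfinite iteration of an enlargement operation `E`, in the form
`G α = ⨆ β < α, E β (G β)`, which treats successor and limit steps uniformly. -/
noncomputable def transfiniteSup {L : Type*} [CompleteLattice L] (E : Ordinal.{u} → L → L)
    (α : Ordinal.{u}) : L :=
  ⨆ β : Set.Iio α, E β (transfiniteSup E β)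
termination_by α
decreasing_by exact β.2

/-- Iterating an enlargement operation which preserves a property closed under directed suprema. -/
lemma exists_transfinite_chain {L : Type*} [CompleteLattice L] (p : L → Prop) (hbot : p ⊥)
    (hp : ∀ 𝒮 : Set L, 𝒮.Nonempty → DirectedOn (· ≤ ·) 𝒮 → (∀ Q ∈ 𝒮, p Q) → p (sSup 𝒮))
    (E : Ordinal.{u} → L → L) (hE : ∀ α Q, p Q → p (E α Q)) (hle : ∀ α Q, Q ≤ E α Q) :
    ∃ G : Ordinal.{u} → L, (∀ α, p (G α)) ∧ Monotone G ∧ G 0 = ⊥ ∧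
      (∀ α, G (α + 1) = E α (G α)) ∧
      ∀ β, Order.IsSuccLimit β → G β = sSup (G '' Set.Iio β) := by
  let G := transfiniteSup E
  have hG (α) : G α = ⨆ β : Set.Iio α, E β (G β) := by
    change transfiniteSup E α = _
    rw [transfiniteSup]
  have hEG {β α : Ordinal.{u}} (h : β < α) : E β (G β) ≤ G α := by
    rw [hG α]
    exact le_iSup (fun β : Set.Iio α => E β (G β)) ⟨β, h⟩
  have hmono : Monotone G := by
    intro β α h
    rcases h.eq_or_lt with rfl | h
    · exact le_rfl
    · exact (hle _ _).trans (hEG h)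
  have hEmono {β γ : Ordinal.{u}} (h : β ≤ γ) : E β (G β) ≤ E γ (G γ) := by
    rcases h.eq_or_lt with rfl | h
    · exact le_rfl
    · exact (hEG h).trans (hle _ _)
  refine ⟨G, fun α => ?_, hmono, ?_, fun α => ?_, fun β hβ => ?_⟩
  · induction α using WellFoundedLT.induction with
    | ind α ih =>
      rw [hG]
      rcases (Set.Iio α).eq_empty_or_nonempty with h | h
      · have := Set.isEmpty_coe_sort.2 h
        rwa [iSup_of_empty]
      · have := h.to_subtype
        refine hp _ (Set.range_nonempty _) (directedOn_range.2 ?_) ?_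
        · exact Monotone.directed_le fun β γ h => hEmono h
        · rintro _ ⟨β, rfl⟩
          exact hE _ _ (ih β β.2)
  · rw [hG]
    have : IsEmpty (Set.Iio (0 : Ordinal.{u})) := ⟨fun β => not_lt_zero (Set.mem_Iio.1 β.2)⟩
    rw [iSup_of_empty]
  · refine le_antisymm ?_ (hEG (Order.lt_add_one_iff.2 le_rfl))
    rw [hG]
    exact iSup_le fun β => hEmono (Order.lt_add_one_iff.1 β.2)
  · refine le_antisymm ?_ (sSup_le ?_)
    · rw [hG β]
      refine iSup_le fun γ => (hEG (Order.lt_add_one_iff.2 le_rfl)).trans (le_sSup ?_)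
      exact ⟨γ + 1, hβ.add_one_lt γ.2, rfl⟩
    · rintro _ ⟨γ, hγ, rfl⟩
      exact hmono (le_of_lt hγ)

variable {R : Type u} [Ring R] {n : ℕ} {X : ChainComplex (ModuleCat.{u} R) ℤ}

lemma projDimLEAleph0_of_subsingleton {M : ModuleCat.{u} R} (hM : Subsingleton M) :
    projDimLEAleph0 R n M := by
  have : Subsingleton (ModuleCat.of R PUnit.{u + 1}) := inferInstanceAs (Subsingleton PUnit)
  refine ⟨fun _ => ModuleCat.of R PUnit, fun _ => 0, 0, fun _ _ => ?_, fun _ _ => this,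
    fun x => ⟨0, Subsingleton.elim _ _⟩, fun x => ?_, fun _ x => ?_⟩
  · have := Module.Free.of_subsingleton R (ModuleCat.of R PUnit.{u + 1})
    exact isCountableSumOfCGProjective_of_isCountablyGenerated Module.Projective.of_free
      ⟨∅, Set.countable_empty, Subsingleton.elim _ _⟩
  · exact ⟨fun _ => ⟨0, Subsingleton.elim (α := ModuleCat.of R PUnit) _ _⟩,
      fun _ => Subsingleton.elim _ _⟩
  · exact ⟨fun _ => ⟨0, Subsingleton.elim (α := ModuleCat.of R PUnit) _ _⟩,
      fun _ => Subsingleton.elim (α := ModuleCat.of R PUnit) _ _⟩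

theorem hasFiltration_of_dw_projDimLE [IsNoetherianRing R] (hX : dw (projDimLE R n) X) :
    HasFiltration (dw (projDimLEAleph0 R n)) X := by
  classical
  obtain ⟨𝒳⟩ := nonempty_resolved hX
  have hcond := 𝒳.isClosureCondition_supplies
  let rank (w : Σ m, X.X m) : Ordinal.{u} := Ordinal.typein WellOrderingRel w
  have hrank : Function.Injective rank := Ordinal.typein_injective _
  -- the elements of `X` to be adjoined in step `α`, of which there is at most one
  let c (α : Ordinal.{u}) (m : ℤ) : Set (X.X m) := {x | rank ⟨m, x⟩ = α}
  have hc (α) (m) : (c α m).Countable := by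
    refine Set.Subsingleton.countable fun x hx y hy => ?_
    have h : rank ⟨m, x⟩ = rank ⟨m, y⟩ := hx.trans hy.symm
    exact eq_of_heq (Sigma.mk.inj (hrank h)).2
  choose E₀ hE₀ hle₀ hmem₀ hdw₀ using
    fun (Q : {Q // 𝒳.IsGood Q}) (α : Ordinal.{u}) => Q.2.exists_extension (hc α)
  let E (α : Ordinal.{u}) (Q : 𝒳.Family) : 𝒳.Family := if h : 𝒳.IsGood Q then E₀ ⟨Q, h⟩ α else Q
  have hE {α : Ordinal.{u}} {Q : 𝒳.Family} (h : 𝒳.IsGood Q) : E α Q = E₀ ⟨Q, h⟩ α := dif_pos h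
  obtain ⟨G, hgood, hmono, hzero, hsucc, hlim⟩ := exists_transfinite_chain 𝒳.IsGood hcond.bot
    (fun 𝒮 => hcond.sSup_closed) E (fun α Q h => by rw [hE h]; exact hE₀ _ _) (fun α Q => by
      by_cases h : 𝒳.IsGood Q
      · rw [hE h]
        exact hle₀ ⟨Q, h⟩ α
      · simp only [E, dif_neg h, le_refl])
  refine ⟨Ordinal.type (α := Σ m, X.X m) WellOrderingRel + 1, fun α => (hgood α).sub,
    ⟨?_, ?_, ?_, ?_, ?_⟩, ?_, ?_⟩
  · exact Order.lt_add_one_iff.2 zero_le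
  · intro m
    exact congrFun hzero (m, 0)
  · exact fun α β h _ m => hmono h (m, 0)
  · intro β hβ _ m x
    suffices ∀ y : 𝒳.term (m, 0), y ∈ G β (m, 0) ↔ ∃ α < β, y ∈ G α (m, 0) from this x
    intro y
    rw [hlim β hβ, mem_sSup_family]
    · simp
    · exact ⟨_, 0, hβ.bot_lt, rfl⟩
    · rintro _ ⟨α, hα, rfl⟩ _ ⟨γ, hγ, rfl⟩
      exact ⟨_, ⟨max α γ, Set.mem_Iio.2 (max_lt hα hγ), rfl⟩, hmono (le_max_left _ _),
        hmono (le_max_right _ _)⟩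
  · intro m x
    have hlt : rank ⟨m, x⟩ < Ordinal.type (α := Σ m, X.X m) WellOrderingRel :=
      Ordinal.typein_lt_type _ _
    refine ⟨rank ⟨m, x⟩ + 1, Order.lt_add_one_iff.2 (Order.add_one_le_of_lt hlt), ?_⟩
    change x ∈ G (rank ⟨m, x⟩ + 1) (m, 0)
    rw [hsucc, hE (hgood _)]
    exact hmem₀ _ _ m x rfl
  · refine ObjectProperty.le_isoClosure _ _ fun m => projDimLEAleph0_of_subsingleton ?_
    change Subsingleton (G 0 (m, 0))
    rw [hzero]
    exact inferInstanceAs (Subsingleton (⊥ : Submodule R (X.X m)))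
  · intro α _
    refine ObjectProperty.le_isoClosure _ _ ?_
    have h : G (α + 1) = E₀ ⟨G α, hgood α⟩ α := (hsucc α).trans (hE (hgood α))
    have key : ∀ (Q : 𝒳.Family) (hQ : 𝒳.IsGood Q), Q = E₀ ⟨G α, hgood α⟩ α →
        dw (projDimLEAleph0 R n) (hQ.sub.quotient (hgood α).sub) := by
      rintro _ _ rfl
      exact hdw₀ ⟨G α, hgood α⟩ α
    exact key _ _ h

end Filtration

/-! ### Sections of an epimorphism over subcomplexes -/

section PartialSections

open Abelian

variable {R : Type u} [Ring R] {X Y E : ChainComplex (ModuleCat.{u} R) ℤ}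

lemma hom_comm_apply (p : E ⟶ X) (i j : ℤ) (e : E.X i) :
    (p.f j).hom ((E.d i j).hom e) = (X.d i j).hom ((p.f i).hom e) := by
  rw [← ModuleCat.comp_apply, ← ModuleCat.comp_apply, p.comm]

/-- The preimage of a subcomplex. -/
def Subcomplex.comap (p : E ⟶ X) (T : Subcomplex X) : Subcomplex E where
  carrier m := (T.carrier m).comap (p.f m).hom
  d_mem i j e he := by
    rw [Submodule.mem_comap, hom_comm_apply]
    exact T.d_mem i j _ he

/-- A section of `p : E ⟶ X` over the subcomplex `T`, encoded by its image `G`: a subcomplex of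
`E` which `p` maps bijectively onto `T`. -/
structure IsPartialSection (p : E ⟶ X) (G : Subcomplex E) (T : Subcomplex X) : Prop where
  injective : ∀ m, ∀ e ∈ G.carrier m, (p.f m).hom e = 0 → e = 0
  map_eq : ∀ m, (G.carrier m).map (p.f m).hom = T.carrier m

lemma IsPartialSection.apply_mem {p : E ⟶ X} {G : Subcomplex E} {T : Subcomplex X}
    (h : IsPartialSection p G T) {m : ℤ} {e : E.X m} (he : e ∈ G.carrier m) :
    (p.f m).hom e ∈ T.carrier m :=
  h.map_eq m ▸ Submodule.mem_map_of_mem he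

lemma IsPartialSection.exists_section {p : E ⟶ X} {G : Subcomplex E} {T : Subcomplex X}
    (h : IsPartialSection p G T) (hT : ∀ m, T.carrier m = ⊤) : ∃ s : X ⟶ E, s ≫ p = 𝟙 X := by
  have hbij (m : ℤ) : Function.Bijective ((p.f m).hom ∘ₗ (G.carrier m).subtype) := by
    constructor
    · rw [injective_iff_map_eq_zero]
      exact fun e he => Subtype.ext (h.injective m e e.2 he)
    · intro x
      have hx : x ∈ (G.carrier m).map (p.f m).hom := by
        rw [h.map_eq, hT]
        trivial
      obtain ⟨e, he, rfl⟩ := hx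
      exact ⟨⟨e, he⟩, rfl⟩
  let r (m : ℤ) := (LinearEquiv.ofBijective _ (hbij m)).symm
  have hr (m : ℤ) (x : X.X m) : (p.f m).hom (r m x) = x :=
    (LinearEquiv.ofBijective _ (hbij m)).apply_symm_apply x
  refine ⟨{ f := fun m => ModuleCat.ofHom ((G.carrier m).subtype ∘ₗ (r m).toLinearMap),
            comm' := fun i j _ => ?_ }, ?_⟩
  · ext x
    have hd : (E.d i j).hom (r i x) ∈ G.carrier j := G.d_mem i j _ (r i x).2
    have : (⟨_, hd⟩ : G.carrier j) = r j ((X.d i j).hom x) := by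
      apply (hbij j).1
      change (p.f j).hom ((E.d i j).hom (r i x)) = (p.f j).hom (r j ((X.d i j).hom x))
      rw [hr, hom_comm_apply, hr]
    exact congrArg Subtype.val this
  · ext m x
    exact hr m x

lemma shortExact_components {i : Y ⟶ E} {p : E ⟶ X} {w : i ≫ p = 0}
    (hS : (ShortComplex.mk i p w).ShortExact) (m : ℤ) :
    Function.Injective (i.f m).hom ∧ Function.Exact (i.f m).hom (p.f m).hom ∧
      Function.Surjective (p.f m).hom := by
  have h := (HomologicalComplex.shortExact_iff_degreewise_shortExact _).1 hS m
  exact ⟨(ModuleCat.mono_iff_injective _).1 h.mono_f,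
    (ShortComplex.ShortExact.moduleCat_exact_iff_function_exact _).1 h.exact,
    (ModuleCat.epi_iff_surjective _).1 h.epi_g⟩

/-- A section over `T` extends to `T' ⊇ T` if `Ext¹(T' / T, Y)` vanishes: dividing the preimage of
`T'` by the given section over `T` yields an extension of `T' / T` by `Y`, and the preimage of the
image of a splitting of it is a section over `T'`. -/
lemma IsPartialSection.exists_extension {i : Y ⟶ E} {p : E ⟶ X} {w : i ≫ p = 0}
    (hS : (ShortComplex.mk i p w).ShortExact) {G : Subcomplex E} {T T' : Subcomplex X}
    (hG : IsPartialSection p G T) (hle : ∀ m, T.carrier m ≤ T'.carrier m)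
    (hext : Subsingleton (Ext.{u} (T'.quotient T) Y 1)) :
    ∃ G' : Subcomplex E, IsPartialSection p G' T' ∧ ∀ m, G.carrier m ≤ G'.carrier m := by
  have hcomp := shortExact_components hS
  let E' := T'.comap p
  have hGT (m : ℤ) : G.carrier m ≤ (T.carrier m).comap (p.f m).hom :=
    fun e he => hG.apply_mem he
  have hGE (m : ℤ) : G.carrier m ≤ E'.carrier m :=
    (hGT m).trans (Submodule.comap_mono (hle m))
  have hi (m : ℤ) (y : Y.X m) : (i.f m).hom y ∈ E'.carrier m := by
    have : (p.f m).hom ((i.f m).hom y) = 0 := (hcomp m).2.1.apply_apply_eq_zero y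
    change (p.f m).hom _ ∈ T'.carrier m
    rw [this]
    exact zero_mem _
  let α : Y ⟶ E'.quotient G :=
    { f m := ModuleCat.ofHom ((Submodule.mkQ (G.inside E' m)) ∘ₗ
        (i.f m).hom.codRestrict (E'.carrier m) (hi m))
      comm' a b _ := by
        ext y
        refine congrArg (Submodule.Quotient.mk (p := G.inside E' b)) (Subtype.ext ?_)
        exact (hom_comm_apply i a b y).symm }
  let β : E'.quotient G ⟶ T'.quotient T :=
    { f m := ModuleCat.ofHom (quotientMap (p.f m).hom (hGT m) (le_refl (E'.carrier m)))
      comm' a b _ := by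
        ext e
        obtain ⟨e, rfl⟩ := Submodule.Quotient.mk_surjective _ e
        refine congrArg (Submodule.Quotient.mk (p := T.inside T' b)) (Subtype.ext ?_)
        exact (hom_comm_apply p a b e.1).symm }
  have hαβ : α ≫ β = 0 := by
    ext m y
    refine (Submodule.Quotient.mk_eq_zero (T.inside T' m)).2 ?_
    change (p.f m).hom ((i.f m).hom y) ∈ T.carrier m
    rw [(hcomp m).2.1.apply_apply_eq_zero y]
    exact zero_mem _
  have hmem (m : ℤ) (e : E.X m) (he : (p.f m).hom e ∈ T.carrier m) :
      ∃ g ∈ G.carrier m, ∃ y, (i.f m).hom y = e - g := by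
    rw [← hG.map_eq] at he
    obtain ⟨g, hg, hge⟩ := he
    exact ⟨g, hg, ((hcomp m).2.1 _).1 (by rw [map_sub, hge, sub_self])⟩
  have hex : (ShortComplex.mk α β hαβ).ShortExact := by
    refine HomologicalComplex.shortExact_of_degreewise_shortExact _ fun m =>
      shortExact_of_function_exact (α.f m) (β.f m) _ ?_ ?_ ?_
    · rw [injective_iff_map_eq_zero]
      intro y hy
      have hy' : (i.f m).hom y ∈ G.carrier m :=
        (Submodule.Quotient.mk_eq_zero (G.inside E' m)).1 hy
      have h0 := hG.injective m _ hy' ((hcomp m).2.1.apply_apply_eq_zero y)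
      exact (hcomp m).1 (h0.trans (map_zero _).symm)
    · intro t
      obtain ⟨⟨t, ht⟩, rfl⟩ := Submodule.Quotient.mk_surjective _ t
      obtain ⟨e, rfl⟩ := (hcomp m).2.2 t
      exact ⟨Submodule.Quotient.mk (p := G.inside E' m) ⟨e, ht⟩, rfl⟩
    · intro e
      constructor
      · obtain ⟨⟨e, he⟩, rfl⟩ := Submodule.Quotient.mk_surjective _ e
        intro h0
        have hT : (p.f m).hom e ∈ T.carrier m :=
          (Submodule.Quotient.mk_eq_zero (T.inside T' m)).1 h0
        obtain ⟨g, hg, y, hy⟩ := hmem m e hT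
        refine ⟨y, (Submodule.Quotient.eq (G.inside E' m)).2 ?_⟩
        change (i.f m).hom y - e ∈ G.carrier m
        rw [hy, sub_sub_cancel_left]
        exact neg_mem hg
      · rintro ⟨y, rfl⟩
        exact congrArg (fun φ => (φ.f m).hom y) hαβ
  obtain ⟨s, hs⟩ := exists_lift_of_subsingleton_ext hex hext (𝟙 _)
  have hs' (m : ℤ) (t : (T'.quotient T).X m) : (β.f m).hom ((s.f m).hom t) = t :=
    congrArg (fun φ => (φ.f m).hom t) hs
  let q (m : ℤ) (e : E'.carrier m) : (E'.quotient G).X m :=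
    Submodule.Quotient.mk (p := G.inside E' m) e
  refine ⟨
    { carrier := fun m => ((LinearMap.range (s.f m).hom).comap
        (Submodule.mkQ (G.inside E' m))).map (E'.carrier m).subtype
      d_mem := ?_ }, ⟨?_, ?_⟩, ?_⟩
  · rintro a b _ ⟨e, ⟨t, ht⟩, rfl⟩
    refine ⟨E'.dRestrict a b e, ⟨((T'.quotient T).d a b).hom t, ?_⟩, rfl⟩
    rw [hom_comm_apply, ht]
    rfl
  · rintro m _ ⟨e, ⟨t, ht⟩, rfl⟩ h0
    have hβ : (β.f m).hom (q m e) = 0 := by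
      refine (Submodule.Quotient.mk_eq_zero (T.inside T' m)).2 ?_
      change (p.f m).hom ((E'.carrier m).subtype e) ∈ T.carrier m
      rw [h0]
      exact zero_mem _
    have ht0 : t = 0 := by
      rw [← hs' m t, ht]
      exact hβ
    rw [ht0, map_zero] at ht
    exact hG.injective m _ ((Submodule.Quotient.mk_eq_zero (G.inside E' m)).1 ht.symm) h0
  · intro m
    apply le_antisymm
    · rintro _ ⟨_, ⟨e, -, rfl⟩, rfl⟩
      exact e.2
    · intro t ht
      let t' : (T'.quotient T).X m := Submodule.Quotient.mk (p := T.inside T' m) ⟨t, ht⟩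
      obtain ⟨e, he⟩ := Submodule.Quotient.mk_surjective (G.inside E' m) ((s.f m).hom t')
      have hpe : (p.f m).hom e.1 - t ∈ T.carrier m := by
        have := hs' m t'
        rw [← he] at this
        exact (Submodule.Quotient.eq (T.inside T' m)).1 this
      rw [← hG.map_eq] at hpe
      obtain ⟨g, hg, hge⟩ := hpe
      refine ⟨e.1 - g, ⟨e - ⟨g, hGE m hg⟩, ⟨t', ?_⟩, rfl⟩, ?_⟩
      · rw [← he]
        refine (Submodule.Quotient.eq (G.inside E' m)).2 ?_
        change e.1 - (e.1 - g) ∈ G.carrier m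
        rwa [sub_sub_cancel]
      · rw [map_sub, hge, sub_sub_cancel]
  · intro m g hg
    refine ⟨⟨g, hGE m hg⟩, ⟨0, ?_⟩, rfl⟩
    rw [map_zero]
    exact ((Submodule.Quotient.mk_eq_zero (G.inside E' m)).2 hg).symm

end PartialSections

/-! ### Eklof's lemma -/

section Eklof

open Abelian

variable {R : Type u} [Ring R]

/-- An element of a directed union in a product lattice lies in one of the members. -/
lemma mem_sSup_prod {A B : Type*} {M : A → Type*} {N : B → Type*} [∀ a, AddCommGroup (M a)]
    [∀ a, Module R (M a)] [∀ b, AddCommGroup (N b)] [∀ b, Module R (N b)]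
    {𝒮 : Set ((∀ a, Submodule R (M a)) × (∀ b, Submodule R (N b)))} (hne : 𝒮.Nonempty)
    (hdir : DirectedOn (· ≤ ·) 𝒮) :
    (∀ (a : A) (x : M a), x ∈ (sSup 𝒮).1 a ↔ ∃ z ∈ 𝒮, x ∈ z.1 a) ∧
      (∀ (b : B) (x : N b), x ∈ (sSup 𝒮).2 b ↔ ∃ z ∈ 𝒮, x ∈ z.2 b) := by
  constructor
  · intro a x
    rw [Prod.fst_sSup, mem_sSup_family (hne.image _)
      (directedOn_image.2 (hdir.mono' fun _ _ _ _ h => h.1))]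
    exact Set.exists_mem_image
  · intro b x
    rw [Prod.snd_sSup, mem_sSup_family (hne.image _)
      (directedOn_image.2 (hdir.mono' fun _ _ _ _ h => h.2))]
    exact Set.exists_mem_image

/-- Eklof's lemma for the filtrations by good families: a section over the subcomplex of a maximal
good family is a section over all of `X`. -/
theorem subsingleton_ext_of_dw_projDimLE [IsNoetherianRing R] {n : ℕ}
    {X Y : ChainComplex (ModuleCat.{u} R) ℤ} (hX : dw (projDimLE R n) X)
    (hY : rightPerp.{u} (dw (projDimLEAleph0 R n)) Y) : Subsingleton (Ext.{u} X Y 1) := by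
  refine subsingleton_ext_of_forall_split fun E i p w hS => ?_
  obtain ⟨𝒳⟩ := nonempty_resolved hX
  have hcond := 𝒳.isClosureCondition_supplies
  let Z : Set (𝒳.Family × (∀ m, Submodule R (E.X m))) := {z | ∃ (hQ : 𝒳.IsGood z.1)
    (G : Subcomplex E), G.carrier = z.2 ∧ IsPartialSection p G hQ.sub}
  have hbot : ⊥ ∈ Z := by
    refine ⟨hcond.bot, ⟨⊥, fun a b x hx => ?_⟩, rfl, ?_, ?_⟩
    · have hx' : x = 0 := hx
      rw [hx', map_zero]
      exact zero_mem _
    · exact fun m e he _ => he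
    · exact fun m => Submodule.map_bot _
  have hchain (c : Set (𝒳.Family × (∀ m, Submodule R (E.X m)))) (hc : c ⊆ Z)
      (hchain : IsChain (· ≤ ·) c) : ∃ ub ∈ Z, ∀ z ∈ c, z ≤ ub := by
    rcases c.eq_empty_or_nonempty with rfl | hne
    · exact ⟨⊥, hbot, by simp⟩
    have hdir := hchain.directedOn
    obtain ⟨hmem₁, hmem₂⟩ := mem_sSup_prod hne hdir
    have hgood : 𝒳.IsGood (sSup c).1 := by
      rw [Prod.fst_sSup]
      refine hcond.sSup_closed (hne.image _)
        (directedOn_image.2 (hdir.mono' fun _ _ _ _ h => h.1)) ?_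
      rintro _ ⟨z, hz, rfl⟩
      exact (hc hz).1
    refine ⟨sSup c, ⟨hgood, ⟨(sSup c).2, fun a b e he => ?_⟩, rfl, fun m e he h0 => ?_,
      fun m => le_antisymm ?_ ?_⟩, fun z hz => le_sSup hz⟩
    · obtain ⟨z, hz, hez⟩ := (hmem₂ a e).1 he
      obtain ⟨hQ, G, hG, h⟩ := hc hz
      rw [← hG] at hez
      exact (hmem₂ b _).2 ⟨z, hz, hG ▸ G.d_mem a b e hez⟩
    · obtain ⟨z, hz, hez⟩ := (hmem₂ m e).1 he
      obtain ⟨hQ, G, hG, h⟩ := hc hz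
      rw [← hG] at hez
      exact h.injective m e hez h0
    · rintro _ ⟨e, he, rfl⟩
      obtain ⟨z, hz, hez⟩ := (hmem₂ m e).1 he
      obtain ⟨hQ, G, hG, h⟩ := hc hz
      rw [← hG] at hez
      exact (hmem₁ (m, 0) _).2 ⟨z, hz, h.apply_mem hez⟩
    · intro x hx
      obtain ⟨z, hz, hxz⟩ := (hmem₁ (m, 0) x).1 hx
      obtain ⟨hQ, G, hG, h⟩ := hc hz
      have hx' : x ∈ (G.carrier m).map (p.f m).hom := by
        rw [h.map_eq]
        exact hxz
      obtain ⟨e, he, rfl⟩ := hx'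
      exact ⟨e, (hmem₂ m e).2 ⟨z, hz, hG ▸ he⟩, rfl⟩
  obtain ⟨⟨Q, _⟩, ⟨hQ, G, rfl, hG⟩, hmax⟩ := zorn_le₀ Z hchain
  refine hG.exists_section fun m => eq_top_iff.2 fun x _ => ?_
  -- the section extends to an enlargement of `Q` containing `x`, which by maximality is `Q` itself
  let c (k : ℤ) : Set (X.X k) := {y | ∃ h : m = k, h ▸ x = y}
  have hc (k : ℤ) : (c k).Countable := by
    refine Set.Subsingleton.countable ?_
    rintro _ ⟨rfl, rfl⟩ _ ⟨_, rfl⟩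
    rfl
  obtain ⟨Q', hQ', hle, hxQ', hdw⟩ := hQ.exists_extension hc
  obtain ⟨G', hG', hGG'⟩ := hG.exists_extension (T' := hQ'.sub) hS
    (fun k => hle (k, 0)) (hY _ hdw)
  exact (hmax (y := (Q', G'.carrier)) ⟨hQ', G', rfl, hG'⟩ ⟨hle, hGG'⟩).1 (m, 0)
    (hxQ' m x ⟨rfl, rfl⟩)

end Eklof

/-! ### The cotorsion pair -/

section CotorsionPair

open Abelian

variable {R : Type u} [Ring R]

lemma dw_projDimLEAleph0_le (n : ℕ) :
    dw (projDimLEAleph0 R n) ≤ dw (projDimLE R n) :=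
  fun _ hX m => projDimLEAleph0_le_projDimLE n _ (hX m)

lemma rightPerp_dw_projDimLE_eq [IsNoetherianRing R] (n : ℕ) :
    rightPerp.{u} (dw (projDimLE R n)) = rightPerp.{u} (dw (projDimLEAleph0 R n)) :=
  le_antisymm (rightPerp_antitone (dw_projDimLEAleph0_le n))
    fun _ hY _ hX => subsingleton_ext_of_dw_projDimLE hX hY

lemma isCotorsionPair_dw_projDimLE (n : ℕ) :
    IsCotorsionPair.{u} (dw (projDimLE R n)) (rightPerp.{u} (dw (projDimLE R n))) :=
  isCotorsionPair_of_eq_leftPerp (dw_projDimLE_eq_leftPerp n)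

end CotorsionPair

end DegreewiseProj

theorem mainTheorem2 {R : Type u} [Ring R] [IsNoetherianRing R] (n : ℕ) :
    (∀ X : ChainComplex (ModuleCat.{u} R) ℤ, DegreewiseProj.dw (DegreewiseProj.projDimLE R n) X →
      DegreewiseProj.HasFiltration (DegreewiseProj.dw (DegreewiseProj.projDimLEAleph0 R n)) X) ∧
    DegreewiseProj.IsCotorsionPair.{u} (DegreewiseProj.dw (DegreewiseProj.projDimLE R n))
      (DegreewiseProj.rightPerp.{u} (DegreewiseProj.dw (DegreewiseProj.projDimLE R n))) ∧
    DegreewiseProj.IsCogeneratedBySet.{u} (DegreewiseProj.dw (DegreewiseProj.projDimLE R n))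
      (DegreewiseProj.rightPerp.{u} (DegreewiseProj.dw (DegreewiseProj.projDimLE R n)))
      (DegreewiseProj.dw (DegreewiseProj.projDimLEAleph0 R n)) ∧
    DegreewiseProj.IsCompletePair (DegreewiseProj.dw (DegreewiseProj.projDimLE R n))
      (DegreewiseProj.rightPerp.{u} (DegreewiseProj.dw (DegreewiseProj.projDimLE R n))) := by
  open DegreewiseProj in
  have hsmall : ObjectProperty.EssentiallySmall.{u} (dw (projDimLEAleph0 R n)) :=
    essentiallySmall_dw fun _ => .of_projDimLEAleph0
  have hperp := rightPerp_dw_projDimLE_eq (R := R) n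
  have hpair := isCotorsionPair_dw_projDimLE (R := R) n
  refine ⟨fun X => hasFiltration_of_dw_projDimLE, hpair,
    ⟨hsmall, dw_projDimLEAleph0_le n, hperp⟩, fun X => ?_, fun Y => ?_⟩
  · obtain ⟨K, A, f, g, h, hK, hA, hS⟩ := exists_special_precover.{u} (dw (projDimLEAleph0 R n)) X
    refine ⟨K, A, f, g, h, hperp ▸ hK, ?_, hS⟩
    rwa [hpair.left_eq, hperp]
  · obtain ⟨B, Q, f, g, h, hB, hQ, hS⟩ :=
      exists_special_preenvelope.{u} (dw (projDimLEAleph0 R n)) Y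
    refine ⟨B, Q, f, g, h, hperp ▸ hB, ?_, hS⟩
    rwa [hpair.left_eq, hperp]
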